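/- Let $n\ge 3$ and let $a,b$ be real numbers with $a<n$ and $b<n$. Let $X=(x_1,\dots,x_n)$ be an independent sample from the bivariate normal distribution with means $\mu_1,\mu_2\in\mathbb R$, standard deviations $\sigma_1,\sigma_2>0$ and correlation $\rho\in(-1,1)$, and put $\eta_3=-\rho/(\sigma_1\sqrt{1-\rho^2})$. Consider the prior density (with respect to $d\mu_1\,d\mu_2\,d\sigma_1\,d\sigma_2\,d\rho$) $$\pi_{ab}(\mu_1,\mu_2,\sigma_1,\sigma_2,\rho)=\frac{1}{\sigma_1^{3-a}\,\sigma_2^{2-b}\,(1-\rho^2)^{2-b/2}},$$ and for $\alpha\in(0,1)$ let $(\eta_3^*)_{1-\alpha}=(\eta_3^*)_{1-\alpha}(X)$ be the $1-\alpha$ quantile of the posterior distribution of $\eta_3$ given $X$ under $\pi_{ab}$. (For almost every $X$ the posterior is proper and gives the event $\eta_3<(\eta_3^*)_{1-\alpha}(X)$ probability exactly $1-\alpha$.) Then: (a) For all $\alpha\in(0,1)$, $\xi=(\mu_1,\mu_2,\sigma_1,\sigma_2)$ with $\sigma_1,\sigma_2>0$, and $\rho\in(-1,1)$, the frequentist coverage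 of the credible interval $(-\infty,(\eta_3^*)_{1-\alpha})$ is $$P\bigl(\eta_3<(\eta_3^*)_{1-\alpha}\mid \xi,\rho\bigr)=P\left(\frac{Z_3+\frac{\rho}{\sqrt{1-\rho^2}}\sqrt{\chi^2_{n-1}}}{\sqrt{\chi^2_{n-2}}}<\left(\frac{Z_3^*+\frac{\rho}{\sqrt{1-\rho^2}}\sqrt{\chi^2_{n-1}}}{\sqrt{\chi^{2*}_{n-b}}}\right)_{1-\alpha}\right),$$ where $Z_3$ is standard normal, $\chi^2_{n-1},\chi^2_{n-2}$ are chi-squared with $n-1$ and $n-2$ degrees of freedom, these three being independent, and where the quantile $(\cdot)_{1-\alpha}$ on the right is computed with $\chi^2_{n-1}$ held fixed, with respect to independent $Z_3^*$ (standard normal) and $\chi^{2*}_{n-b}$ (chi-squared with $n-b$ degrees of freedom). (b) For each $\alpha\in(0,1)$ and each $\xi$, this coverage equals $1-\alpha$ for every $\rho\in(-1,1)$ if and only if $b=2$. -/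

import Mathlib

open MeasureTheory ProbabilityTheory

namespace BivariateNormal

/-- The parameter `(μ₁, μ₂, σ₁, σ₂, ρ)`; as a product of copies of `ℝ` it carries the
Lebesgue measure `dμ₁ dμ₂ dσ₁ dσ₂ dρ`. -/
abbrev Param : Type := ℝ × ℝ × ℝ × ℝ × ℝ

/-- The parameter space: `σ₁ > 0`, `σ₂ > 0` and `-1 < ρ < 1`. -/
def paramSpace : Set Param :=
  {θ | match θ with
    | (_, _, σ₁, σ₂, ρ) => 0 < σ₁ ∧ 0 < σ₂ ∧ -1 < ρ ∧ ρ < 1}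

/-- The density of the bivariate normal distribution with means `μ₁, μ₂`, standard deviations
`σ₁, σ₂` and correlation `ρ`. -/
noncomputable def pdf : Param → ℝ × ℝ → ℝ
  | (μ₁, μ₂, σ₁, σ₂, ρ), (x₁, x₂) =>
    1 / (2 * Real.pi * σ₁ * σ₂ * √(1 - ρ ^ 2)) *
      Real.exp (-((σ₂ ^ 2 * (x₁ - μ₁) ^ 2 + σ₁ ^ 2 * (x₂ - μ₂) ^ 2
          - 2 * ρ * σ₁ * σ₂ * (x₁ - μ₁) * (x₂ - μ₂)) /
        (2 * σ₁ ^ 2 * σ₂ ^ 2 * (1 - ρ ^ 2))))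

/-- The bivariate normal distribution. -/
noncomputable def law (θ : Param) : Measure (ℝ × ℝ) :=
  volume.withDensity fun x => ENNReal.ofReal (pdf θ x)

/-- The law of an independent sample of size `n`. -/
noncomputable def sampleLaw (n : ℕ) (θ : Param) : Measure (Fin n → ℝ × ℝ) :=
  Measure.pi fun _ => law θ

/-- The prior density `π_ab` (with respect to Lebesgue measure on the parameter space). -/
noncomputable def prior (a b : ℝ) : Param → ℝ
  | (_, _, σ₁, σ₂, ρ) => 1 / (σ₁ ^ (3 - a) * σ₂ ^ (2 - b) * (1 - ρ ^ 2) ^ (2 - b / 2))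

/-- Prior times likelihood, as a (not normalized) measure on the parameters. -/
noncomputable def priorTimesLikelihood (a b : ℝ) {n : ℕ} (X : Fin n → ℝ × ℝ) : Measure Param :=
  (volume.restrict paramSpace).withDensity fun θ =>
    ENNReal.ofReal (prior a b θ * ∏ k, pdf θ (X k))

/-- The posterior distribution of the parameter under `π_ab`, given the sample `X`. -/
noncomputable def posterior (a b : ℝ) {n : ℕ} (X : Fin n → ℝ × ℝ) : Measure Param :=
  (priorTimesLikelihood a b X Set.univ)⁻¹ • priorTimesLikelihood a b X

/-- The parameter of interest, `η₃ = -ρ / (σ₁ √(1 - ρ²))`. -/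
noncomputable def eta3 : Param → ℝ
  | (_, _, σ₁, _, ρ) => -(ρ / (σ₁ * √(1 - ρ ^ 2)))

/-- The quantile of order `p` of a distribution on the real line. -/
noncomputable def quantile (P : Measure ℝ) (p : ℝ) : ℝ :=
  sInf {x : ℝ | p ≤ P.real (Set.Iic x)}

/-- The posterior quantile of `η₃` of order `1 - α` under `π_ab`. -/
noncomputable def eta3Quantile (a b α : ℝ) {n : ℕ} (X : Fin n → ℝ × ℝ) : ℝ :=
  quantile ((posterior a b X).map eta3) (1 - α)

/-- The frequentist coverage, at the true parameter `θ`, of the one-sided credible interval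
`(-∞, eta3Quantile a b α X)`: the probability, over the sample `X`, that it contains `η₃`. -/
noncomputable def coverage (n : ℕ) (a b α : ℝ) (θ : Param) : ℝ :=
  (sampleLaw n θ).real {X | eta3 θ < eta3Quantile a b α X}

/-- The chi-squared distribution with `ν > 0` degrees of freedom. -/
noncomputable def chiSquared (ν : ℝ) : Measure ℝ :=
  gammaMeasure (ν / 2) (1 / 2)

/-- The `1 - α` quantile of `(Z* + m) / √χ*`, where `Z*` is standard normal and `χ*` is
chi-squared with `ν` degrees of freedom, independent of `Z*`, and `m` is held fixed. -/
noncomputable def starQuantile (ν α m : ℝ) : ℝ :=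
  quantile (((gaussianReal 0 1).prod (chiSquared ν)).map fun p => (p.1 + m) / √p.2) (1 - α)

/-- The probability, over independent `Z₃` (standard normal), `χ²_{n-1}` and `χ²_{n-2}`, that
`(Z₃ + ρ / √(1 - ρ²) √χ²_{n-1}) / √χ²_{n-2}` is less than the `1 - α` quantile of
`(Z₃* + ρ / √(1 - ρ²) √χ²_{n-1}) / √χ²*_{n-b}`, the latter with `χ²_{n-1}` held fixed.
In the code `p = (Z₃, χ²_{n-1}, χ²_{n-2})`. -/
noncomputable def coverageFormula (n : ℕ) (b α ρ : ℝ) : ℝ :=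
  ((gaussianReal 0 1).prod ((chiSquared ((n : ℝ) - 1)).prod (chiSquared ((n : ℝ) - 2)))).real
    {p : ℝ × ℝ × ℝ |
      (p.1 + ρ / √(1 - ρ ^ 2) * √p.2.1) / √p.2.2 <
        starQuantile ((n : ℝ) - b) α (ρ / √(1 - ρ ^ 2) * √p.2.1)}

end BivariateNormal

/-! The Cholesky factor of the precision matrix has entries `p = 1/σ₁`, `e = η₃`, `q =
1/(σ₂√(1-ρ²))`: the exponent of the density is `-((p(x₁-μ₁))² + (e(x₁-μ₁) + q(x₂-μ₂))²)/2`
(`pdf_eq_cholesky`). Integrating out the means leaves `(pq)^(n-1)` times the exponential of a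
quadratic form in the centered sums of squares and products `S₁₁, S₁₂, S₂₂`. The exponents of the
prior are such that, in the coordinates `(σ₁, q, η₃)`, the factor in `σ₁` splits off and `(q, η₃)`
has density proportional to `u^(n-b-1) exp(-(S₁₁y² + 2S₁₂yu + S₂₂u²)/2)` at `(u, y)`. Completing the
square in `y`, with `D = S₂₂ - S₁₂²/S₁₁`, shows that a posteriori `D q²` is chi-squared with `n-b`
degrees of freedom and that `η₃` is distributed as `(Z* - t√χ*)/√S₁₁`, where `t = S₁₂/√(S₁₁D)`
(`lintegral_star`, `posterior_map_eta3`).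

So `η₃` lies below its posterior quantile exactly when `P(Z* - η₃√S₁₁ ≤ t√χ*) < 1-α`. Under the true
parameter put `c = ρ/√(1-ρ²)`; the sampling law of the statistics (`sampleLaw_map_statistics`) turns
`-η₃√S₁₁` into `c√χ²_{n-1}` and `t` into `(Z₃ + c√χ²_{n-1})/√χ²_{n-2}`. This is the coverage formula
(`coverage_eq_coverageFormula`).

If `b = 2`, then conditionally on `χ²_{n-1}` the two ratios have the same continuous law, and
matching is exact (`coverageFormula_two`). Conversely, let `c → ∞`. The normal terms become
negligible, and the coverage tends to `P(χ²_{n-2} > q)` with `q` now the `α` quantile of `χ²_{n-b}`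
(`tendsto_coverageFormula`). This can equal `1-α = P(χ²_{n-b} > q)` only if the degrees of freedom
agree, because the ratio of two chi-squared densities is strictly monotone (`chiSquared_Ioi_ne`). -/

namespace BivariateNormal

/-! ### Quantiles and distribution functions -/

section Quantile

open Set Filter Topology

/-- The quantile function is the lower adjoint of the distribution function. -/
theorem quantile_le_iff (P : Measure ℝ) [IsProbabilityMeasure P] {p : ℝ} (hp : p ∈ Ioo (0 : ℝ) 1)
    (x : ℝ) : quantile P p ≤ x ↔ p ≤ P.real (Iic x) := by
  simp only [quantile, ← cdf_eq_real]
  have hne : {x : ℝ | p ≤ cdf P x}.Nonempty := by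
    obtain ⟨y, hy⟩ := ((tendsto_cdf_atTop P).eventually (lt_mem_nhds hp.2)).exists
    exact ⟨y, hy.le⟩
  have hbdd : BddBelow {x : ℝ | p ≤ cdf P x} := by
    obtain ⟨y, hy⟩ := ((tendsto_cdf_atBot P).eventually (gt_mem_nhds hp.1)).exists
    refine ⟨y, fun z hz => ?_⟩
    by_contra! h
    exact absurd (hz.trans (monotone_cdf P h.le)) (not_le.2 hy)
  refine ⟨fun h => ?_, fun h => csInf_le hbdd h⟩
  -- Right continuity of the distribution function makes the infimum a minimum.
  have hq : p ≤ cdf P (sInf {x : ℝ | p ≤ cdf P x}) := by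
    have hc := ((cdf P).right_continuous (sInf {x : ℝ | p ≤ cdf P x})).tendsto.mono_left
      (nhdsWithin_mono _ Ioi_subset_Ici_self)
    refine ge_of_tendsto hc ?_
    filter_upwards [self_mem_nhdsWithin] with y hy
    obtain ⟨s, hs, hsy⟩ := exists_lt_of_csInf_lt hne hy
    exact le_trans hs (monotone_cdf P hsy.le)
  exact hq.trans (monotone_cdf P h)

theorem lt_quantile_iff (P : Measure ℝ) [IsProbabilityMeasure P] {p : ℝ} (hp : p ∈ Ioo (0 : ℝ) 1)
    (x : ℝ) : x < quantile P p ↔ P.real (Iic x) < p := by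
  rw [← not_le, quantile_le_iff P hp, not_le]

/-- Without atoms the distribution function is continuous at the quantile: it is below `p` to the
left and at least `p` at the point itself. -/
theorem measureReal_Iio_quantile (P : Measure ℝ) [IsProbabilityMeasure P]
    (hP : ∀ x, P {x} = 0) {p : ℝ} (hp : p ∈ Ioo (0 : ℝ) 1) :
    P.real (Iio (quantile P p)) = p := by
  set q := quantile P p
  have h1 : P.real (Iio q) = P.real (Iic q) := by
    rw [← Iio_union_right, measureReal_union (by simp) (measurableSet_singleton q)]
    simp [measureReal_def, hP]
  refine le_antisymm ?_ ?_
  · have hlim : Tendsto (fun x => cdf P x) (𝓝[<] q) (𝓝 (P.real (Iio q))) := by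
      have h2 := (cdf P).mono.tendsto_leftLim q
      have h3 : P {q} = ENNReal.ofReal (cdf P q - Function.leftLim (cdf P) q) := by
        conv_lhs => rw [← measure_cdf P]
        exact (cdf P).measure_singleton q
      rw [hP, eq_comm, ENNReal.ofReal_eq_zero] at h3
      have h4 := (cdf P).mono.leftLim_le (le_refl q)
      rw [h1, ← cdf_eq_real, show cdf P q = Function.leftLim (cdf P) q by linarith]
      exact h2
    refine le_of_tendsto hlim ?_
    filter_upwards [self_mem_nhdsWithin] with x hx
    rw [cdf_eq_real]
    exact ((lt_quantile_iff P hp x).1 hx).le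
  · rw [h1]
    exact (quantile_le_iff P hp q).1 le_rfl

end Quantile

/-! ### Basic properties of the chi-squared law -/

section ChiSquared

theorem isProbabilityMeasure_chiSquared {ν : ℝ} (hν : 0 < ν) :
    IsProbabilityMeasure (chiSquared ν) :=
  isProbabilityMeasure_gammaMeasure (by positivity) (by norm_num)

theorem chiSquared_absolutelyContinuous (ν : ℝ) : chiSquared ν ≪ volume :=
  withDensity_absolutelyContinuous _ _

theorem ae_pos_chiSquared (ν : ℝ) : ∀ᵐ x ∂chiSquared ν, 0 < x := by
  rw [chiSquared, gammaMeasure, ae_withDensity_iff (by unfold gammaPDF; fun_prop)]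
  filter_upwards [(measure_eq_zero_iff_ae_notMem.1 (measure_singleton (μ := volume) (0 : ℝ)))] with x hx h
  rcases lt_trichotomy x 0 with h' | h' | h'
  · exact absurd (gammaPDF_of_neg h') h
  · exact absurd h' hx
  · exact h'

end ChiSquared

/-! ### The quantile of the ratio with fixed shift -/

section StarQuantile

open Set

/-- The distribution function at `t` of `(Z* + m) / √χ*`, where `Z*` is standard normal and `χ*`
is chi-squared with `ν` degrees of freedom, independent of `Z*`. -/
noncomputable def starCDF (ν m t : ℝ) : ℝ :=
  ((gaussianReal 0 1).prod (chiSquared ν)).real {p | p.1 + m ≤ t * √p.2}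

theorem ae_pos_snd (ν : ℝ) [IsProbabilityMeasure (chiSquared ν)] :
    ∀ᵐ p ∂(gaussianReal 0 1).prod (chiSquared ν), 0 < p.2 :=
  Measure.quasiMeasurePreserving_snd.ae (ae_pos_chiSquared ν)

theorem measureReal_Iic_star {ν : ℝ} (hν : 0 < ν) (m t : ℝ) :
    (((gaussianReal 0 1).prod (chiSquared ν)).map fun p => (p.1 + m) / √p.2).real (Iic t) =
      starCDF ν m t := by
  have := isProbabilityMeasure_chiSquared hν
  rw [map_measureReal_apply (by fun_prop) measurableSet_Iic, starCDF]
  refine measureReal_congr ?_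
  filter_upwards [ae_pos_snd ν] with p hp
  refine propext ?_
  change (p.1 + m) / √p.2 ≤ t ↔ p.1 + m ≤ t * √p.2
  exact div_le_iff₀ (Real.sqrt_pos.2 hp)

/-- Replaces the infimum defining the quantile by a distribution function that is jointly measurable
in shift and threshold, so that events about the quantile can be transported and integrated. -/
theorem lt_starQuantile_iff {ν α : ℝ} (hν : 0 < ν) (hα : α ∈ Ioo (0 : ℝ) 1) (m t : ℝ) :
    t < starQuantile ν α m ↔ starCDF ν m t < 1 - α := by
  have := isProbabilityMeasure_chiSquared hν
  have : IsProbabilityMeasure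
      (((gaussianReal 0 1).prod (chiSquared ν)).map fun p : ℝ × ℝ => (p.1 + m) / √p.2) :=
    Measure.isProbabilityMeasure_map (by fun_prop)
  rw [starQuantile, lt_quantile_iff _ ⟨by linarith [hα.2], by linarith [hα.1]⟩,
    measureReal_Iic_star hν]

/-- Each horizontal slice is one point, and the Gaussian has no atoms. This is the source of
atomlessness for all the ratios below. -/
theorem gaussian_prod_graph_eq_zero (Q : Measure ℝ) [IsProbabilityMeasure Q] {g : ℝ → ℝ}
    (hg : Measurable g) :
    ((gaussianReal 0 1).prod Q) {p | p.1 = g p.2} = 0 := by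
  have hs : MeasurableSet {p : ℝ × ℝ | p.1 = g p.2} :=
    measurableSet_eq_fun measurable_fst (hg.comp measurable_snd)
  rw [Measure.prod_apply_symm hs]
  have hfib : ∀ y, (fun x : ℝ => (x, y)) ⁻¹' {p : ℝ × ℝ | p.1 = g p.2} = {g y} := by
    intro y; ext x; simp
  simp_rw [hfib]
  have := nullSingletonClass_gaussianReal (μ := 0) (v := 1) one_ne_zero
  simp

theorem measurable_starCDF {ν : ℝ} (hν : 0 < ν) :
    Measurable fun q : ℝ × ℝ => starCDF ν q.1 q.2 := by
  have := isProbabilityMeasure_chiSquared hν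
  have hs : MeasurableSet {r : (ℝ × ℝ) × (ℝ × ℝ) | r.2.1 + r.1.1 ≤ r.1.2 * √r.2.2} :=
    measurableSet_le (by fun_prop) (by fun_prop)
  exact (measurable_measure_prodMk_left hs).ennreal_toReal

/-- For `χ*` with the right degrees of freedom the star quantile is exact. -/
theorem measureReal_lt_starQuantile {ν α : ℝ} (hν : 0 < ν) (hα : α ∈ Ioo (0 : ℝ) 1) (m : ℝ) :
    ((gaussianReal 0 1).prod (chiSquared ν)).real
      {p | (p.1 + m) / √p.2 < starQuantile ν α m} = 1 - α := by
  have := isProbabilityMeasure_chiSquared hν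
  have : IsProbabilityMeasure
      (((gaussianReal 0 1).prod (chiSquared ν)).map fun p : ℝ × ℝ => (p.1 + m) / √p.2) :=
    Measure.isProbabilityMeasure_map (by fun_prop)
  have key := measureReal_Iio_quantile
    (((gaussianReal 0 1).prod (chiSquared ν)).map fun p : ℝ × ℝ => (p.1 + m) / √p.2) ?_
    (p := 1 - α) ⟨by linarith [hα.2], by linarith [hα.1]⟩
  · rw [map_measureReal_apply (by fun_prop) measurableSet_Iio] at key
    exact key
  · intro x
    rw [Measure.map_apply (by fun_prop) (measurableSet_singleton x)]
    rw [← gaussian_prod_graph_eq_zero (chiSquared ν) (g := fun w => x * √w - m) (by fun_prop)]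
    refine measure_congr ?_
    filter_upwards [ae_pos_snd ν] with p hp
    refine propext ?_
    change (p.1 + m) / √p.2 = x ↔ p.1 = x * √p.2 - m
    rw [div_eq_iff (Real.sqrt_pos.2 hp).ne', eq_sub_iff_add_eq]

end StarQuantile

/-! ### Sums of squares of standard normals -/

section ChiSquaredLaw

open Set

theorem mgf_chiSquared {ν : ℝ} (hν : 0 < ν) (t : ℝ) :
    mgf id (chiSquared ν) t = if t < 1 / 2 then (1 - 2 * t) ^ (-(ν / 2)) else 0 := by
  have ha : 0 < ν / 2 := by positivity
  have hΓ := Real.Gamma_pos_of_pos ha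
  have h1 : mgf id (chiSquared ν) t = ∫ x in Ioi (0 : ℝ),
      ((1 / 2) ^ (ν / 2) / Real.Gamma (ν / 2)) *
        (x ^ (ν / 2 - 1) * Real.exp (-((1 / 2 - t) * x))) := by
    rw [mgf, chiSquared, gammaMeasure, integral_withDensity_eq_integral_toReal_smul
      (by unfold gammaPDF; fun_prop) (by simp [gammaPDF])]
    rw [← integral_Ici_eq_integral_Ioi, ← integral_indicator measurableSet_Ici]
    refine integral_congr_ae (Filter.Eventually.of_forall fun x => ?_)
    have h0 := ENNReal.toReal_ofReal (gammaPDFReal_nonneg ha (by norm_num : (0 : ℝ) < 1 / 2) x)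
    simp only [gammaPDF, h0]
    simp only [gammaPDFReal, indicator, mem_Ici, id, smul_eq_mul]
    split_ifs with h
    · rw [mul_assoc, mul_assoc, ← Real.exp_add]
      congr 3
      ring_nf
    · simp
  rw [h1, integral_const_mul]
  split_ifs with h
  · rw [Real.integral_rpow_mul_exp_neg_mul_Ioi ha (by linarith), Real.rpow_neg (by linarith),
      show (1 : ℝ) / (1 / 2 - t) = 2 * (1 - 2 * t)⁻¹ by
        rw [show (1 : ℝ) / 2 - t = (1 - 2 * t) / 2 by ring]; field_simp,
      Real.mul_rpow (by norm_num) (inv_nonneg.2 (by linarith)), Real.inv_rpow (by linarith),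
      one_div, Real.inv_rpow (by norm_num)]
    field_simp
  · rw [integral_undef, mul_zero]
    intro hint
    -- For `t ≥ 1/2` the integrand dominates a pure power, and no power is integrable on the whole
    -- half-line; the moment generating function then takes the default value `0`.
    refine not_integrableOn_Ioi_rpow (ν / 2 - 1) (hint.mono' (by fun_prop) ?_)
    filter_upwards [ae_restrict_mem measurableSet_Ioi] with x hx
    have hx : 0 < x := hx
    rw [Real.norm_of_nonneg (by positivity)]
    refine le_mul_of_one_le_right (by positivity) (Real.one_le_exp ?_)
    nlinarith

theorem mgf_sq_gaussian (t : ℝ) :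
    mgf (fun x : ℝ => x ^ 2) (gaussianReal 0 1) t =
      if t < 1 / 2 then (1 - 2 * t) ^ (-(1 / 2 : ℝ)) else 0 := by
  have h1 : mgf (fun x : ℝ => x ^ 2) (gaussianReal 0 1) t =
      (√(2 * Real.pi))⁻¹ * ∫ x : ℝ, Real.exp (-(1 / 2 - t) * x ^ 2) := by
    rw [mgf, integral_gaussianReal_eq_integral_smul one_ne_zero, ← integral_const_mul]
    refine integral_congr_ae (Filter.Eventually.of_forall fun x => ?_)
    simp only [gaussianPDFReal, smul_eq_mul, NNReal.coe_one, mul_one, sub_zero]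
    rw [mul_assoc, ← Real.exp_add]
    congr 2
    ring
  rw [h1, integral_gaussian]
  split_ifs with h
  · have h2 : (0 : ℝ) < 1 - 2 * t := by linarith
    rw [Real.rpow_neg h2.le, ← Real.sqrt_eq_rpow, ← Real.sqrt_inv, ← Real.sqrt_inv,
      ← Real.sqrt_mul (by positivity)]
    congr 1
    rw [show (1 : ℝ) / 2 - t = (1 - 2 * t) / 2 by ring]
    field_simp
  · rw [Real.sqrt_eq_zero_of_nonpos (x := Real.pi / _), mul_zero]
    exact div_nonpos_of_nonneg_of_nonpos Real.pi_pos.le (by linarith)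

/-- The moment generating functions agree everywhere and are finite near `0`, so their analytic
continuations agree on the imaginary axis, where they are the characteristic functions. -/
theorem map_sum_sq_eq_chiSquared (k : ℕ) (hk : k ≠ 0) :
    (Measure.pi fun _ : Fin k => gaussianReal 0 1).map (fun x => ∑ i, x i ^ 2) =
      chiSquared k := by
  have hk0 : (0 : ℝ) < k := by exact_mod_cast Nat.pos_of_ne_zero hk
  have := isProbabilityMeasure_chiSquared hk0
  have hm : Measurable fun x : Fin k → ℝ => ∑ i, x i ^ 2 := by fun_prop
  set μ := (Measure.pi fun _ : Fin k => gaussianReal 0 1).map (fun x => ∑ i, x i ^ 2)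
  have : IsProbabilityMeasure μ := Measure.isProbabilityMeasure_map hm.aemeasurable
  have hmgf : mgf id μ = mgf id (chiSquared k) := by
    ext t
    rw [mgf_chiSquared hk0, mgf_id_map hm.aemeasurable, mgf]
    have : ∀ x : Fin k → ℝ, Real.exp (t * ∑ i, x i ^ 2) = ∏ i, Real.exp (t * x i ^ 2) := by
      intro x; rw [Finset.mul_sum, Real.exp_sum]
    simp_rw [this]
    rw [integral_fintype_prod_eq_prod (f := fun _ y => Real.exp (t * y ^ 2))]
    have h2 := mgf_sq_gaussian t
    rw [mgf] at h2
    simp only [h2, Finset.prod_const, Finset.card_univ, Fintype.card_fin]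
    split_ifs with h
    · rw [← Real.rpow_natCast, ← Real.rpow_mul (by linarith)]
      congr 1; ring
    -- Both sides carry the default value `0`; the product of `k` zeros is `0` because `k ≠ 0`.
    · simp [hk]
  have hint : (0 : ℝ) ∈ interior (integrableExpSet id μ) := by
    rw [mem_interior]
    refine ⟨Iio (1 / 2), fun t ht => ?_, isOpen_Iio, by norm_num⟩
    have ht : t < 1 / 2 := ht
    rw [integrableExpSet, mem_ofPred_eq, ← mgf_pos_iff, hmgf, mgf_chiSquared hk0, if_pos ht]
    exact Real.rpow_pos_of_pos (by linarith) _
  refine Measure.ext_of_charFun ?_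
  ext t
  rw [← complexMGF_id_mul_I, ← complexMGF_id_mul_I]
  exact eqOn_complexMGF_of_mgf hmgf (by simpa using hint)

end ChiSquaredLaw

/-! ### Joint law of the centered statistics of two standard normal samples -/

section SampleStatistics

open Set

/-- The centered cross product `∑ (x k - x̄) (y k - ȳ)`. -/
noncomputable def crossProduct {n : ℕ} (x y : Fin n → ℝ) : ℝ :=
  ∑ k, x k * y k - (∑ k, x k) * (∑ k, y k) / n

@[fun_prop]
theorem measurable_crossProduct {n : ℕ} {δ : Type*} [MeasurableSpace δ] {f g : δ → Fin n → ℝ}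
    (hf : Measurable f) (hg : Measurable g) : Measurable fun x => crossProduct (f x) (g x) := by
  unfold crossProduct
  fun_prop

/-- The standard normal law on `Fin n → ℝ`. -/
noncomputable abbrev stdNormal (n : ℕ) : Measure (Fin n → ℝ) :=
  Measure.pi fun _ => gaussianReal 0 1

/-- Rotation invariance of the standard Gaussian: independent normal coordinates may be taken along
any orthonormal basis. -/
theorem stdNormal_map_orthonormalBasis {n : ℕ}
    (b : OrthonormalBasis (Fin n) ℝ (EuclideanSpace ℝ (Fin n))) :
    (stdNormal n).map (fun x => WithLp.ofLp (∑ i, x i • b i)) = stdNormal n := by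
  have h1 := map_pi_eq_stdGaussian (ι := Fin n)
  rw [stdGaussian_eq_map_pi_orthonormalBasis b] at h1
  have h2 := congrArg (Measure.map (WithLp.ofLp)) h1
  rw [Measure.map_map (by fun_prop) (by fun_prop), Measure.map_map (by fun_prop) (by fun_prop)]
    at h2
  have h3 : (WithLp.ofLp ∘ WithLp.toLp 2 : (Fin n → ℝ) → (Fin n → ℝ)) = id := rfl
  rw [h3, Measure.map_id] at h2
  exact h2.symm

theorem stdNormal_map_tail (n : ℕ) :
    MeasurePreserving (fun x : Fin (n + 1) → ℝ => (x 0, fun i : Fin n => x i.succ))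
      (stdNormal (n + 1)) ((gaussianReal 0 1).prod (stdNormal n)) := by
  exact measurePreserving_piFinSuccAbove (fun _ : Fin (n + 1) => gaussianReal 0 1) 0

/-- The unit vector along the diagonal. -/
noncomputable def diagVec (n : ℕ) : EuclideanSpace ℝ (Fin n) :=
  WithLp.toLp 2 fun _ => 1 / √n

theorem inner_diagVec {n : ℕ} (v : EuclideanSpace ℝ (Fin n)) :
    inner ℝ (diagVec n) v = (∑ k, v k) / √n := by
  simp [diagVec, PiLp.inner_apply, div_eq_mul_inv, Finset.sum_mul]

theorem inner_diagVec_self {n : ℕ} (hn : n ≠ 0) :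
    inner ℝ (diagVec n) (diagVec n) = 1 := by
  have : (0 : ℝ) < n := by exact_mod_cast Nat.pos_of_ne_zero hn
  rw [inner_diagVec]
  simp only [diagVec, Finset.sum_const, Finset.card_univ, Fintype.card_fin, nsmul_eq_mul]
  have h := Real.mul_self_sqrt this.le
  have h' := (Real.sqrt_pos.2 this).ne'
  field_simp
  nlinarith

/-- The unit vector along the centered vector `z - z̄`. -/
noncomputable def centeredVec {n : ℕ} (z : Fin n → ℝ) : EuclideanSpace ℝ (Fin n) :=
  WithLp.toLp 2 fun k => (z k - (∑ k, z k) / n) / √(crossProduct z z)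

theorem inner_centeredVec {n : ℕ} (z : Fin n → ℝ) (v : EuclideanSpace ℝ (Fin n)) :
    inner ℝ (centeredVec z) v = crossProduct z v / √(crossProduct z z) := by
  have : crossProduct z v = ∑ k, v k * (z k - (∑ k, z k) / n) := by
    simp only [crossProduct, mul_sub, Finset.sum_sub_distrib, ← Finset.sum_mul]
    congr 1
    · exact Finset.sum_congr rfl fun k _ => mul_comm _ _
    · ring
  rw [this, Finset.sum_div]
  simp only [centeredVec, PiLp.inner_apply, RCLike.inner_apply, conj_trivial]
  exact Finset.sum_congr rfl fun k _ => by ring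

theorem inner_diagVec_centeredVec {n : ℕ} (hn : n ≠ 0) (z : Fin n → ℝ) :
    inner ℝ (diagVec n) (centeredVec z) = 0 := by
  have : (n : ℝ) ≠ 0 := by exact_mod_cast hn
  rw [inner_diagVec]
  simp only [centeredVec, ← Finset.sum_div, Finset.sum_sub_distrib, Finset.sum_const,
    Finset.card_univ, Fintype.card_fin, nsmul_eq_mul]
  field_simp
  simp

theorem inner_centeredVec_self {n : ℕ} (hn : n ≠ 0) {z : Fin n → ℝ} (hz : 0 < crossProduct z z) :
    inner ℝ (centeredVec z) (centeredVec z) = 1 := by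
  have hn' : (n : ℝ) ≠ 0 := by exact_mod_cast hn
  have h0 : ∑ k, centeredVec z k = 0 := by
    have := inner_diagVec_centeredVec hn z
    rw [inner_diagVec, div_eq_zero_iff] at this
    rcases this with h | h
    · exact h
    · exact absurd ((Real.sqrt_eq_zero (by positivity)).1 h) hn'
  have h1 : ∑ k, z k * centeredVec z k = √(crossProduct z z) := by
    have : ∑ k, z k * (z k - (∑ k, z k) / n) = crossProduct z z := by
      simp only [crossProduct, mul_sub, Finset.sum_sub_distrib, ← Finset.sum_mul]
      ring
    simp only [centeredVec, ← mul_div_assoc, ← Finset.sum_div, this]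
    exact Real.div_sqrt
  rw [inner_centeredVec, crossProduct, h0, h1]
  simp [(Real.sqrt_pos.2 hz).ne']

/-- Pythagoras: centering is the orthogonal projection away from the diagonal. -/
theorem crossProduct_self_eq {n : ℕ} (v : EuclideanSpace ℝ (Fin n)) :
    crossProduct v v = ‖v‖ ^ 2 - inner ℝ (diagVec n) v ^ 2 := by
  rw [EuclideanSpace.real_norm_sq_eq, inner_diagVec, crossProduct, div_pow,
    Real.sq_sqrt (by positivity)]
  simp [pow_two]

theorem norm_sq_sum_smul {n : ℕ} (b : OrthonormalBasis (Fin n) ℝ (EuclideanSpace ℝ (Fin n)))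
    (x : Fin n → ℝ) : ‖∑ i, x i • b i‖ ^ 2 = ∑ i, x i ^ 2 := by
  rw [← b.sum_sq_inner_right]
  simp [b.orthonormal.inner_right_fintype]

/-- The centered sum of squares of a standard normal sample is chi-squared. -/
theorem map_crossProduct_self (n : ℕ) :
    (stdNormal (n + 2)).map (fun z => crossProduct z z) = chiSquared ((n : ℝ) + 1) := by
  -- In a basis starting with the diagonal direction, centering deletes coordinate `0` and leaves `n
  -- + 1` squares.
  obtain ⟨b, hb⟩ := Orthonormal.exists_orthonormalBasis_extension_of_card_eq (𝕜 := ℝ)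
    (E := EuclideanSpace ℝ (Fin (n + 2))) (ι := Fin (n + 2)) (by simp)
    (v := fun _ => diagVec (n + 2)) (s := {0}) (by
      rw [orthonormal_iff_ite]
      rintro ⟨i, rfl⟩ ⟨j, rfl⟩
      simpa using inner_diagVec_self (n := n + 2) (by simp))
  have hb0 : b 0 = diagVec (n + 2) := hb 0 rfl
  rw [← stdNormal_map_orthonormalBasis b, Measure.map_map (by fun_prop) (by fun_prop)]
  have : ((fun z : Fin (n + 2) → ℝ => crossProduct z z) ∘ fun x => WithLp.ofLp (∑ i, x i • b i)) =
      (fun y : Fin (n + 1) → ℝ => ∑ i, y i ^ 2) ∘ Prod.snd ∘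
        fun x : Fin (n + 2) → ℝ => (x 0, fun i : Fin (n + 1) => x i.succ) := by
    ext x
    simp only [Function.comp]
    rw [crossProduct_self_eq, norm_sq_sum_smul, ← hb0, b.orthonormal.inner_right_fintype,
      Fin.sum_univ_succ]
    ring
  rw [this, ← Measure.map_map (by fun_prop) (by fun_prop),
    (measurePreserving_snd.comp (stdNormal_map_tail (n + 1))).map_eq,
    map_sum_sq_eq_chiSquared _ (by simp)]
  push_cast; rfl

/-- Given the first sample, the regression coefficient of the second one and the residual sum of
squares are independent. -/
theorem map_regression (n : ℕ) {z : Fin (n + 3) → ℝ} (hz : 0 < crossProduct z z) :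
    (stdNormal (n + 3)).map (fun w => (crossProduct z w / √(crossProduct z z),
      crossProduct w w - crossProduct z w ^ 2 / crossProduct z z)) =
      (gaussianReal 0 1).prod (chiSquared ((n : ℝ) + 1)) := by
  have h10 : inner ℝ (centeredVec z) (diagVec (n + 3)) = 0 := by
    rw [real_inner_comm, inner_diagVec_centeredVec (by simp)]
  -- With the diagonal and the centered `z` as first two basis vectors, the normalized cross product
  -- is coordinate `1`, and the residual is the sum of the other `n + 1` squares.
  obtain ⟨b, hb⟩ := Orthonormal.exists_orthonormalBasis_extension_of_card_eq (𝕜 := ℝ)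
    (E := EuclideanSpace ℝ (Fin (n + 3))) (ι := Fin (n + 3)) (by simp)
    (v := fun i => if i = 1 then centeredVec z else diagVec (n + 3)) (s := {0, 1}) (by
      rw [orthonormal_iff_ite]
      rintro ⟨i, rfl | rfl⟩ ⟨j, rfl | rfl⟩ <;>
      simp [h10, inner_diagVec_centeredVec, inner_centeredVec_self, hz, inner_diagVec_self,
        -inner_self_eq_norm_sq_to_K, Subtype.ext_iff])
  have hb0 : b 0 = diagVec (n + 3) := by simpa using hb 0 (by simp)
  have hb1 : b 1 = centeredVec z := by simpa using hb 1 (by simp)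
  conv_lhs => rw [← stdNormal_map_orthonormalBasis b]
  rw [Measure.map_map (by fun_prop) (by fun_prop)]
  have : ((fun w : Fin (n + 3) → ℝ => (crossProduct z w / √(crossProduct z z),
      crossProduct w w - crossProduct z w ^ 2 / crossProduct z z)) ∘
        fun x => WithLp.ofLp (∑ i, x i • b i)) =
      Prod.map id (fun y : Fin (n + 1) → ℝ => ∑ i, y i ^ 2) ∘
        (fun x : Fin (n + 2) → ℝ => (x 0, fun i : Fin (n + 1) => x i.succ)) ∘ Prod.snd ∘
        fun x : Fin (n + 3) → ℝ => (x 0, fun i : Fin (n + 2) => x i.succ) := by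
    ext1 x
    have h1 : crossProduct z (WithLp.ofLp (∑ i, x i • b i)) / √(crossProduct z z) = x 1 := by
      rw [← inner_centeredVec, ← hb1, b.orthonormal.inner_right_fintype]
    have h2 : crossProduct z (WithLp.ofLp (∑ i, x i • b i)) ^ 2 / crossProduct z z = x 1 ^ 2 := by
      rw [← h1, div_pow, Real.sq_sqrt hz.le]
    simp only [Function.comp, Prod.map_apply, h1, h2]
    rw [crossProduct_self_eq (∑ i, x i • b i), norm_sq_sum_smul, ← hb0,
      b.orthonormal.inner_right_fintype, Fin.sum_univ_succ, Fin.sum_univ_succ]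
    simp
  rw [this, ← Measure.map_map (by fun_prop) (by fun_prop),
    ((stdNormal_map_tail (n + 1)).comp
      (measurePreserving_snd.comp (stdNormal_map_tail (n + 2)))).map_eq,
    ← Measure.map_prod_map _ _ (by fun_prop) (by fun_prop), Measure.map_id,
    map_sum_sq_eq_chiSquared _ (by simp)]
  push_cast; rfl

/-- Conditioning on the middle variable, which plays the role of `χ²_{n-1}`. -/
theorem lintegral_prod_middle {α β γ : Type*} [MeasurableSpace α] [MeasurableSpace β]
    [MeasurableSpace γ] (μ : Measure α) (ν : Measure β) (κ : Measure γ) [SFinite μ] [SFinite ν]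
    [SFinite κ] {f : α × β × γ → ENNReal} (hf : Measurable f) :
    ∫⁻ p, f p ∂μ.prod (ν.prod κ) = ∫⁻ y, (∫⁻ q, f (q.1, y, q.2) ∂μ.prod κ) ∂ν := by
  have h1 : ∀ y, (∫⁻ q, f (q.1, y, q.2) ∂μ.prod κ) = ∫⁻ x, ∫⁻ z, f (x, y, z) ∂κ ∂μ := fun y =>
    lintegral_prod (fun q : α × γ => f (q.1, y, q.2)) (by fun_prop)
  have h2 : ∀ x, (∫⁻ q, f (x, q) ∂ν.prod κ) = ∫⁻ y, ∫⁻ z, f (x, y, z) ∂κ ∂ν := fun x =>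
    lintegral_prod (fun q : β × γ => f (x, q)) (by fun_prop)
  rw [lintegral_prod _ hf.aemeasurable]
  simp_rw [h1, h2]
  refine lintegral_lintegral_swap (f := fun x y => ∫⁻ z, f (x, y, z) ∂κ) ?_
  exact (Measurable.lintegral_prod_right' (f := fun r : (α × β) × γ => f (r.1.1, r.1.2, r.2))
    (by fun_prop)).aemeasurable

/-- By `map_regression` the law of the first and third entries given the first sample `z` is the
same for almost every `z`; hence they are independent of the middle entry, a function of `z` alone.
-/
theorem map_sampleStatistics (n : ℕ) (hn : 3 ≤ n) :
    ((stdNormal n).prod (stdNormal n)).map (fun p =>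
      (crossProduct p.1 p.2 / √(crossProduct p.1 p.1), crossProduct p.1 p.1,
        crossProduct p.2 p.2 - crossProduct p.1 p.2 ^ 2 / crossProduct p.1 p.1)) =
      (gaussianReal 0 1).prod ((chiSquared ((n : ℝ) - 1)).prod (chiSquared ((n : ℝ) - 2))) := by
  obtain ⟨n, rfl⟩ : ∃ m, n = m + 3 := ⟨n - 3, by omega⟩
  rw [show ((n + 3 : ℕ) : ℝ) - 1 = (n + 1 : ℕ) + 1 by push_cast; ring,
    show ((n + 3 : ℕ) : ℝ) - 2 = n + 1 by push_cast; ring]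
  have i1 := isProbabilityMeasure_chiSquared (ν := (n + 1 : ℕ) + 1) (by positivity)
  have i2 := isProbabilityMeasure_chiSquared (ν := (n : ℝ) + 1) (by positivity)
  have hpos : ∀ᵐ z ∂stdNormal (n + 3), 0 < crossProduct z z := by
    have := ae_pos_chiSquared ((n + 1 : ℕ) + 1)
    rw [← map_crossProduct_self (n + 1)] at this
    exact ae_of_ae_map (by fun_prop) this
  refine Measure.ext_of_lintegral _ fun f hf => ?_
  rw [lintegral_map hf (by fun_prop), lintegral_prod _ (by fun_prop)]
  have h1 : ∀ᵐ z ∂stdNormal (n + 3), (∫⁻ w, f (crossProduct z w / √(crossProduct z z),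
      crossProduct z z, crossProduct w w - crossProduct z w ^ 2 / crossProduct z z)
        ∂stdNormal (n + 3)) =
      ∫⁻ q, f (q.1, crossProduct z z, q.2) ∂(gaussianReal 0 1).prod (chiSquared ((n : ℝ) + 1)) := by
    filter_upwards [hpos] with z hz
    rw [← map_regression n hz, lintegral_map (by fun_prop) (by fun_prop)]
  rw [lintegral_congr_ae h1]
  have h2 : Measurable fun a => ∫⁻ q, f (q.1, a, q.2)
      ∂(gaussianReal 0 1).prod (chiSquared ((n : ℝ) + 1)) :=
    Measurable.lintegral_prod_right' (f := fun r : ℝ × (ℝ × ℝ) => f (r.2.1, r.1, r.2.2))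
      (by fun_prop)
  rw [← lintegral_map (f := fun a => ∫⁻ q, f (q.1, a, q.2)
      ∂(gaussianReal 0 1).prod (chiSquared ((n : ℝ) + 1))) h2
    (g := fun z : Fin (n + 3) → ℝ => crossProduct z z) (by fun_prop),
    map_crossProduct_self (n + 1), lintegral_prod_middle _ _ _ hf]

end SampleStatistics

/-! ### The bivariate sample as an affine image of standard normals -/

section SampleLaw

open Set

theorem lintegral_eq_lintegral_affine {c : ℝ} (hc : c ≠ 0) (d : ℝ) (g : ℝ → ENNReal) :
    ∫⁻ x, g x = ENNReal.ofReal |c| * ∫⁻ w, g (c * w + d) := by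
  have h1 := lintegral_image_eq_lintegral_abs_deriv_mul (s := univ) (f := fun w => c * w + d)
    (f' := fun _ => c) MeasurableSet.univ
    (fun x _ => (((hasDerivAt_id' x).const_mul c).add_const d |>.congr_deriv
      (mul_one c)).hasDerivWithinAt)
    (fun x _ y _ h => by simpa [hc] using h) g
  have h2 : (fun w => c * w + d) '' univ = univ := by
    refine eq_univ_of_forall fun x => ⟨(x - d) / c, mem_univ _, ?_⟩
    field_simp; ring
  rw [h2, setLIntegral_univ, setLIntegral_univ, lintegral_const_mul' _ _ ENNReal.ofReal_ne_top]
    at h1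
  exact h1

@[fun_prop]
theorem measurable_pdf (θ : Param) : Measurable (pdf θ) := by
  obtain ⟨μ₁, μ₂, σ₁, σ₂, ρ⟩ := θ
  unfold pdf
  fun_prop

/-- The triangular substitution `x₁ = σ₁z + μ₁`, `x₂ = σ₂√(1-ρ²)w + σ₂ρz + μ₂` decorrelates the
density; the factor in front is its Jacobian. -/
theorem pdf_standardize {σ₁ σ₂ ρ : ℝ} (h₁ : 0 < σ₁) (h₂ : 0 < σ₂) (hρ : ρ ∈ Ioo (-1 : ℝ) 1)
    (μ₁ μ₂ z w : ℝ) :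
    σ₁ * (σ₂ * √(1 - ρ ^ 2)) * pdf (μ₁, μ₂, σ₁, σ₂, ρ)
      (σ₁ * z + μ₁, σ₂ * √(1 - ρ ^ 2) * w + (σ₂ * ρ * z + μ₂)) =
      gaussianPDFReal 0 1 z * gaussianPDFReal 0 1 w := by
  have hr : 0 < 1 - ρ ^ 2 := by nlinarith [hρ.1, hρ.2]
  have hr2 := Real.sq_sqrt hr.le
  set r := √(1 - ρ ^ 2) with hrdef
  have hr0 : 0 < r := Real.sqrt_pos.2 hr
  have hπ := Real.pi_pos
  simp only [gaussianPDFReal, pdf, ← hrdef, NNReal.coe_one, mul_one, sub_zero]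
  rw [mul_mul_mul_comm _ (Real.exp _), ← Real.exp_add, ← mul_inv, Real.mul_self_sqrt (by positivity)]
  have : -((σ₂ ^ 2 * (σ₁ * z + μ₁ - μ₁) ^ 2 +
      σ₁ ^ 2 * (σ₂ * r * w + (σ₂ * ρ * z + μ₂) - μ₂) ^ 2 -
      2 * ρ * σ₁ * σ₂ * (σ₁ * z + μ₁ - μ₁) * (σ₂ * r * w + (σ₂ * ρ * z + μ₂) - μ₂)) /
      (2 * σ₁ ^ 2 * σ₂ ^ 2 * (1 - ρ ^ 2))) = -z ^ 2 / 2 + -w ^ 2 / 2 := by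
    rw [← hr2]
    field_simp
    have : ρ ^ 2 = 1 - r ^ 2 := by linarith
    ring_nf
    rw [this]
    ring
  rw [this]
  field_simp

theorem law_eq_map {σ₁ σ₂ ρ : ℝ} (h₁ : 0 < σ₁) (h₂ : 0 < σ₂) (hρ : ρ ∈ Ioo (-1 : ℝ) 1)
    (μ₁ μ₂ : ℝ) :
    law (μ₁, μ₂, σ₁, σ₂, ρ) = ((gaussianReal 0 1).prod (gaussianReal 0 1)).map (fun p =>
      (σ₁ * p.1 + μ₁, σ₂ * √(1 - ρ ^ 2) * p.2 + (σ₂ * ρ * p.1 + μ₂))) := by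
  have hr : 0 < 1 - ρ ^ 2 := by nlinarith [hρ.1, hρ.2]
  have hr0 : 0 < √(1 - ρ ^ 2) := Real.sqrt_pos.2 hr
  refine Measure.ext_of_lintegral _ fun f hf => ?_
  rw [lintegral_map hf (by fun_prop), gaussianReal_of_var_ne_zero _ one_ne_zero,
    prod_withDensity (by fun_prop) (by fun_prop), lintegral_withDensity_eq_lintegral_mul _
      (by fun_prop) (by fun_prop), law, lintegral_withDensity_eq_lintegral_mul _
      (by fun_prop) hf, Measure.volume_eq_prod, lintegral_prod _ (by fun_prop),
      lintegral_prod _ (by fun_prop)]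
  rw [lintegral_eq_lintegral_affine h₁.ne' μ₁]
  rw [← lintegral_const_mul' _ _ ENNReal.ofReal_ne_top]
  refine lintegral_congr fun z => ?_
  rw [lintegral_eq_lintegral_affine (mul_pos h₂ hr0).ne' (σ₂ * ρ * z + μ₂), ← mul_assoc,
    ← lintegral_const_mul' _ _ (by finiteness)]
  refine lintegral_congr fun w => ?_
  simp only [Pi.mul_apply]
  rw [← mul_assoc, gaussianPDF, gaussianPDF, ← ENNReal.ofReal_mul (abs_nonneg _),
    ← ENNReal.ofReal_mul (by positivity), ← ENNReal.ofReal_mul (gaussianPDFReal_nonneg _ _ _),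
    ← pdf_standardize h₁ h₂ hρ μ₁ μ₂, abs_of_pos h₁, abs_of_pos (mul_pos h₂ hr0)]

theorem sampleLaw_eq_map (n : ℕ) {σ₁ σ₂ ρ : ℝ} (h₁ : 0 < σ₁) (h₂ : 0 < σ₂)
    (hρ : ρ ∈ Ioo (-1 : ℝ) 1) (μ₁ μ₂ : ℝ) :
    sampleLaw n (μ₁, μ₂, σ₁, σ₂, ρ) = ((stdNormal n).prod (stdNormal n)).map (fun p k =>
      (σ₁ * p.1 k + μ₁, σ₂ * √(1 - ρ ^ 2) * p.2 k + (σ₂ * ρ * p.1 k + μ₂))) := by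
  rw [sampleLaw]
  simp_rw [law_eq_map h₁ h₂ hρ μ₁ μ₂]
  have := fun _ : Fin n => Measure.isProbabilityMeasure_map
    (μ := (gaussianReal 0 1).prod (gaussianReal 0 1)) (f := fun p : ℝ × ℝ =>
      (σ₁ * p.1 + μ₁, σ₂ * √(1 - ρ ^ 2) * p.2 + (σ₂ * ρ * p.1 + μ₂))) (by fun_prop)
  rw [← Measure.pi_map_pi (by fun_prop), ← (measurePreserving_arrowProdEquivProdArrow ℝ ℝ (Fin n)
    (fun _ => gaussianReal 0 1) (fun _ => gaussianReal 0 1)).map_eq,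
    Measure.map_map (by fun_prop) (by fun_prop)]
  rfl

end SampleLaw

/-! ### Sampling distribution of the sufficient statistics -/

section Statistics

open Set

variable {n : ℕ}

/-- The centered sum of squares of the first coordinates. -/
noncomputable def ss₁ (X : Fin n → ℝ × ℝ) : ℝ := crossProduct (fun k => (X k).1) fun k => (X k).1

/-- The centered sum of products. -/
noncomputable def ss₁₂ (X : Fin n → ℝ × ℝ) : ℝ := crossProduct (fun k => (X k).1) fun k => (X k).2

/-- The centered sum of squares of the second coordinates. -/
noncomputable def ss₂ (X : Fin n → ℝ × ℝ) : ℝ := crossProduct (fun k => (X k).2) fun k => (X k).2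

/-- The residual sum of squares in the regression of the second coordinates on the first ones. -/
noncomputable def rss (X : Fin n → ℝ × ℝ) : ℝ := ss₂ X - ss₁₂ X ^ 2 / ss₁ X

@[fun_prop]
theorem measurable_ss₁ : Measurable (ss₁ (n := n)) := by unfold ss₁; fun_prop

@[fun_prop]
theorem measurable_ss₁₂ : Measurable (ss₁₂ (n := n)) := by unfold ss₁₂; fun_prop

@[fun_prop]
theorem measurable_rss : Measurable (rss (n := n)) := by unfold rss ss₂; fun_prop

/-- The centered cross product is bilinear and symmetric and ignores constant shifts. -/
theorem crossProduct_affine (hn : n ≠ 0) (x y : Fin n → ℝ) (a b c d e f : ℝ) :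
    crossProduct (fun k => a * x k + (b * y k + c)) (fun k => d * x k + (e * y k + f)) =
      a * d * crossProduct x x + (a * e + b * d) * crossProduct x y +
        b * e * crossProduct y y := by
  have hn' : (n : ℝ) ≠ 0 := by exact_mod_cast hn
  have h1 : ∑ k, (a * x k + (b * y k + c)) * (d * x k + (e * y k + f)) =
      a * d * ∑ k, x k * x k + (a * e + b * d) * ∑ k, x k * y k + b * e * ∑ k, y k * y k +
      (a * f + c * d) * ∑ k, x k + (b * f + c * e) * ∑ k, y k + n * (c * f) := by
    simp only [Finset.mul_sum, ← Finset.sum_add_distrib]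
    rw [show (n : ℝ) * (c * f) = ∑ _k : Fin n, c * f by simp, ← Finset.sum_add_distrib]
    exact Finset.sum_congr rfl fun k _ => by ring
  have h2 : ∀ p q s : ℝ, ∑ k, (p * x k + (q * y k + s)) =
      p * ∑ k, x k + q * ∑ k, y k + n * s := by
    intro p q s
    simp only [Finset.mul_sum, Finset.sum_add_distrib]
    simp; ring
  simp only [crossProduct, h1, h2]
  field_simp
  ring

/-- Distribution of the sufficient statistics. -/
theorem sampleLaw_map_statistics (hn : 3 ≤ n) {σ₁ σ₂ ρ : ℝ} (h₁ : 0 < σ₁) (h₂ : 0 < σ₂)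
    (hρ : ρ ∈ Ioo (-1 : ℝ) 1) (μ₁ μ₂ : ℝ) :
    (sampleLaw n (μ₁, μ₂, σ₁, σ₂, ρ)).map (fun X => (ss₁ X, ss₁₂ X, rss X)) =
      ((gaussianReal 0 1).prod
        ((chiSquared ((n : ℝ) - 1)).prod (chiSquared ((n : ℝ) - 2)))).map fun p =>
        (σ₁ ^ 2 * p.2.1, σ₁ * √p.2.1 * (σ₂ * (ρ * √p.2.1 + √(1 - ρ ^ 2) * p.1)),
          σ₂ ^ 2 * (1 - ρ ^ 2) * p.2.2) := by
  have hr : 0 < 1 - ρ ^ 2 := by nlinarith [hρ.1, hρ.2]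
  have hn1 : (0 : ℝ) < n - 1 := by have : (3 : ℝ) ≤ n := by exact_mod_cast hn
                                   linarith
  have hn2 : (0 : ℝ) < n - 2 := by have : (3 : ℝ) ≤ n := by exact_mod_cast hn
                                   linarith
  have i1 := isProbabilityMeasure_chiSquared hn1
  have i2 := isProbabilityMeasure_chiSquared hn2
  have hpos : ∀ᵐ p ∂(stdNormal n).prod (stdNormal n), 0 < crossProduct p.1 p.1 := by
    have h : ∀ᵐ q ∂(gaussianReal 0 1).prod
        ((chiSquared ((n : ℝ) - 1)).prod (chiSquared ((n : ℝ) - 2))), 0 < q.2.1 :=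
      (Measure.quasiMeasurePreserving_fst.comp Measure.quasiMeasurePreserving_snd).ae
        (ae_pos_chiSquared _)
    rw [← map_sampleStatistics n hn] at h
    exact ae_of_ae_map (p := fun q : ℝ × ℝ × ℝ => 0 < q.2.1) (by fun_prop) h
  rw [sampleLaw_eq_map n h₁ h₂ hρ, Measure.map_map (by fun_prop) (by fun_prop),
    ← map_sampleStatistics n hn, Measure.map_map (by fun_prop) (by fun_prop)]
  refine Measure.map_congr ?_
  filter_upwards [hpos] with p hp
  have hs := Real.sqrt_pos.2 hp
  have hs2 := Real.sq_sqrt hp.le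
  have hr2 := Real.sq_sqrt hr.le
  have hn0 : n ≠ 0 := by omega
  set r := √(1 - ρ ^ 2)
  have e1 : ss₁ (fun k => (σ₁ * p.1 k + μ₁, σ₂ * r * p.2 k + (σ₂ * ρ * p.1 k + μ₂))) =
      σ₁ ^ 2 * crossProduct p.1 p.1 := by
    have := crossProduct_affine hn0 p.1 p.2 σ₁ 0 μ₁ σ₁ 0 μ₁
    simp only [zero_mul, zero_add] at this
    rw [ss₁, this]; ring
  have e2 : ss₁₂ (fun k => (σ₁ * p.1 k + μ₁, σ₂ * r * p.2 k + (σ₂ * ρ * p.1 k + μ₂))) =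
      σ₁ * σ₂ * (ρ * crossProduct p.1 p.1 + r * crossProduct p.1 p.2) := by
    have := crossProduct_affine hn0 p.1 p.2 σ₁ 0 μ₁ (σ₂ * ρ) (σ₂ * r) μ₂
    simp only [zero_mul, zero_add] at this
    rw [ss₁₂]
    calc _ = _ := by congr 1; ext k; ring
      _ = _ := this
      _ = _ := by ring
  have e3 : ss₂ (fun k => (σ₁ * p.1 k + μ₁, σ₂ * r * p.2 k + (σ₂ * ρ * p.1 k + μ₂))) =
      σ₂ ^ 2 * (ρ ^ 2 * crossProduct p.1 p.1 + 2 * ρ * r * crossProduct p.1 p.2 +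
        r ^ 2 * crossProduct p.2 p.2) := by
    have := crossProduct_affine hn0 p.1 p.2 (σ₂ * ρ) (σ₂ * r) μ₂ (σ₂ * ρ) (σ₂ * r) μ₂
    rw [ss₂]
    calc _ = _ := by congr 1 <;> (ext k; ring)
      _ = _ := this
      _ = _ := by ring
  simp only [Function.comp, rss, e1, e2, e3]
  set s := √(crossProduct p.1 p.1)
  rw [← hs2, ← hr2]
  refine Prod.ext rfl (Prod.ext ?_ ?_)
  · simp only
    field_simp
  · simp only
    field_simp
    ring

end Statistics

/-! ### One-dimensional changes of variables -/

section Substitutions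

open Set

theorem lintegral_comp_affine {c : ℝ} (hc : c ≠ 0) (d : ℝ) (g : ℝ → ENNReal) :
    ∫⁻ w, g (c * w + d) = ENNReal.ofReal |c|⁻¹ * ∫⁻ x, g x := by
  rw [lintegral_eq_lintegral_affine hc d g, ← mul_assoc, ← ENNReal.ofReal_mul (by positivity),
    inv_mul_cancel₀ (by positivity), ENNReal.ofReal_one, one_mul]

/-- Used with `r = √(1-ρ²)` to pass from `σ₂` to `u = 1/(σ₂ r)` at fixed `ρ`. -/
theorem lintegral_Ioi_comp_inv {r : ℝ} (hr : 0 < r) (g : ℝ → ENNReal) :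
    ∫⁻ x in Ioi 0, g x = ∫⁻ u in Ioi 0, ENNReal.ofReal (1 / (r * u ^ 2)) * g (1 / (u * r)) := by
  have h := lintegral_image_eq_lintegral_abs_deriv_mul (s := Ioi 0) (f := fun u => 1 / (u * r))
    (f' := fun u => -(1 / (r * u ^ 2))) measurableSet_Ioi ?_ ?_ g
  · have him : (fun u => 1 / (u * r)) '' Ioi 0 = Ioi (0 : ℝ) := by
      ext x
      simp only [mem_image, mem_Ioi]
      refine ⟨fun ⟨u, hu, h⟩ => h ▸ by positivity, fun hx => ⟨1 / (x * r), by positivity, ?_⟩⟩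
      field_simp
    rw [him] at h
    rw [h]
    refine setLIntegral_congr_fun measurableSet_Ioi fun u hu => ?_
    have hu : 0 < u := hu
    simp only [abs_neg]
    rw [abs_of_pos (by positivity)]
  · intro u hu
    have hu : 0 < u := hu
    have h1 := (((hasDerivAt_id' u).mul_const r).inv (by positivity)).hasDerivWithinAt (s := Ioi 0)
    simp only [one_div]
    refine h1.congr_deriv ?_
    field_simp
  · intro x hx y hy h
    have hx : 0 < x := hx
    have hy : 0 < y := hy
    simp only at h
    field_simp at h
    exact h.symm

theorem lintegral_Ioi_comp_mul_sq {D : ℝ} (hD : 0 < D) (g : ℝ → ENNReal) :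
    ∫⁻ x in Ioi 0, g x = ∫⁻ u in Ioi 0, ENNReal.ofReal (2 * D * u) * g (D * u ^ 2) := by
  have h := lintegral_image_eq_lintegral_abs_deriv_mul (s := Ioi 0) (f := fun u => D * u ^ 2)
    (f' := fun u => 2 * D * u) measurableSet_Ioi ?_ ?_ g
  · have him : (fun u => D * u ^ 2) '' Ioi 0 = Ioi (0 : ℝ) := by
      ext x
      simp only [mem_image, mem_Ioi]
      refine ⟨fun ⟨u, hu, h⟩ => h ▸ by positivity, fun hx => ⟨√(x / D), by positivity, ?_⟩⟩
      rw [Real.sq_sqrt (by positivity)]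
      field_simp
    rw [him] at h
    rw [h]
    refine setLIntegral_congr_fun measurableSet_Ioi fun u hu => ?_
    have hu : 0 < u := hu
    rw [abs_of_pos (by positivity)]
  · intro u hu
    refine (((hasDerivAt_pow 2 u).const_mul D).congr_deriv ?_).hasDerivWithinAt
    norm_num; ring
  · intro x hx y hy h
    have hx : 0 < x := hx
    have hy : 0 < y := hy
    simp only at h
    exact (sq_eq_sq₀ hx.le hy.le).1 (mul_left_cancel₀ hD.ne' h)

theorem div_sqrt_mem_Ioo (c : ℝ) : c / √(1 + c ^ 2) ∈ Ioo (-1 : ℝ) 1 := by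
  have h0 : 0 < √(1 + c ^ 2) := by positivity
  have h1 : |c| < √(1 + c ^ 2) := by
    rw [← Real.sqrt_sq_eq_abs]
    exact Real.sqrt_lt_sqrt (by positivity) (by linarith)
  rw [abs_lt] at h1
  constructor
  · rw [lt_div_iff₀ h0]; linarith
  · rw [div_lt_iff₀ h0]; linarith

theorem div_sqrt_one_sub_sq (c : ℝ) :
    c / √(1 + c ^ 2) / √(1 - (c / √(1 + c ^ 2)) ^ 2) = c := by
  have h0 : 0 < √(1 + c ^ 2) := by positivity
  have h2 : 1 - (c / √(1 + c ^ 2)) ^ 2 = (√(1 + c ^ 2))⁻¹ ^ 2 := by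
    rw [div_pow, inv_pow, Real.sq_sqrt (by positivity)]
    field_simp
    ring
  rw [h2, Real.sqrt_sq (by positivity)]
  field_simp

/-- The map `ρ ↦ ρ/√(1-ρ²)` is a bijection from `(-1, 1)` onto the line, with inverse `c ↦
c/√(1+c²)` and derivative `(1-ρ²)^(-3/2)`. -/
theorem lintegral_eq_lintegral_Ioo_div_sqrt (g : ℝ → ENNReal) :
    ∫⁻ c, g c = ∫⁻ ρ in Ioo (-1) 1, ENNReal.ofReal (1 / √(1 - ρ ^ 2) ^ 3) *
      g (ρ / √(1 - ρ ^ 2)) := by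
  have key : ∀ ρ ∈ Ioo (-1 : ℝ) 1, 0 < 1 - ρ ^ 2 := fun ρ hρ => by nlinarith [hρ.1, hρ.2]
  have h := lintegral_image_eq_lintegral_abs_deriv_mul (s := Ioo (-1) 1)
    (f := fun ρ => ρ / √(1 - ρ ^ 2))
    (f' := fun ρ => 1 / √(1 - ρ ^ 2) ^ 3) measurableSet_Ioo ?_ ?_ g
  · have him : (fun ρ => ρ / √(1 - ρ ^ 2)) '' Ioo (-1) 1 = univ := by
      exact eq_univ_of_forall fun c => ⟨_, div_sqrt_mem_Ioo c, div_sqrt_one_sub_sq c⟩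
    rw [him, setLIntegral_univ] at h
    rw [h]
    refine setLIntegral_congr_fun measurableSet_Ioo fun ρ hρ => ?_
    have := Real.sqrt_pos.2 (key ρ hρ)
    rw [abs_of_pos (by positivity)]
  · intro ρ hρ
    have h0 := key ρ hρ
    have h1 := Real.sqrt_pos.2 h0
    have h2 := Real.sq_sqrt h0.le
    have hd := ((hasDerivAt_id' ρ).div ((((hasDerivAt_pow 2 ρ).const_sub 1)).sqrt h0.ne')
      h1.ne').hasDerivWithinAt (s := Ioo (-1) 1)
    refine hd.congr_deriv ?_
    set r := √(1 - ρ ^ 2)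
    have h3 : ρ ^ 2 = 1 - r ^ 2 := by linarith
    field_simp
    norm_num
    linarith
  · intro x hx y hy h
    simp only at h
    have hx0 := key x hx
    have hy0 := key y hy
    have hx1 := Real.sqrt_pos.2 hx0
    have hy1 := Real.sqrt_pos.2 hy0
    rw [div_eq_div_iff hx1.ne' hy1.ne'] at h
    have h2 : x ^ 2 * (1 - y ^ 2) = y ^ 2 * (1 - x ^ 2) := by
      rw [← Real.sq_sqrt hx0.le, ← Real.sq_sqrt hy0.le, ← mul_pow, ← mul_pow, h]
    have h3 : x ^ 2 = y ^ 2 := by linarith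
    rw [h3] at h
    exact mul_right_cancel₀ hy1.ne' h

end Substitutions

/-! ### The density of the ratio variable -/

section Star

open Set

/-- Unnormalized joint density of `(u, y) = (1 / (σ₂ √(1 - ρ²)), η₃)` under the posterior,
integrated against a function of `y`. -/
noncomputable def etaIntegral (ν s₁ s₁₂ s₂ : ℝ) (f : ℝ → ENNReal) : ENNReal :=
  ∫⁻ u in Ioi 0, ∫⁻ y, ENNReal.ofReal
    (u ^ (ν - 1) * Real.exp (-(s₁ * y ^ 2 + 2 * s₁₂ * y * u + s₂ * u ^ 2) / 2)) * f y

/-- With `D = s₂ - s₁₂²/s₁`, substitute `χ* = D u²` and `Z* = √s₁ y + (s₁₂/√s₁) u`. The ratio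
becomes `y`, and `D u² + Z*²` is the quadratic form with its square completed in `y`. The constant
`C` does not depend on `f`. -/
theorem lintegral_star {ν s₁ s₁₂ s₂ : ℝ} (hν : 0 < ν) (hs : 0 < s₁)
    (hD : 0 < s₂ - s₁₂ ^ 2 / s₁) :
    ∃ C : ENNReal, C ≠ 0 ∧ C ≠ ⊤ ∧ ∀ f : ℝ → ENNReal, Measurable f →
      ∫⁻ p, f ((p.1 - s₁₂ / √(s₁ * (s₂ - s₁₂ ^ 2 / s₁)) * √p.2) / √s₁)
        ∂(gaussianReal 0 1).prod (chiSquared ν) = C * etaIntegral ν s₁ s₁₂ s₂ f := by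
  set D := s₂ - s₁₂ ^ 2 / s₁ with hDdef
  have hs₂ : s₂ = D + s₁₂ ^ 2 / s₁ := by rw [hDdef]; ring
  have hΓ := Real.Gamma_pos_of_pos (show 0 < ν / 2 by positivity)
  have i1 := isProbabilityMeasure_chiSquared hν
  have hq := Real.sqrt_pos.2 hs
  have hq2 := Real.sq_sqrt hs.le
  have hπ := Real.pi_pos
  -- Gamma normalization, the power of `D` from `χ* = D u²`, its Jacobian `2D` (whose factor `u`
  -- joins `u^(ν-1)`), Gaussian normalization, and the Jacobian `√s₁`.
  set c : ℝ := (1 / 2) ^ (ν / 2) / Real.Gamma (ν / 2) * D ^ (ν / 2 - 1) * (2 * D) *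
    (√(2 * Real.pi))⁻¹ * √s₁ with hc
  have hc0 : 0 < c := by positivity
  refine ⟨ENNReal.ofReal c, by simpa using hc0, ENNReal.ofReal_ne_top, fun f hf => ?_⟩
  rw [lintegral_prod_symm _ (by fun_prop)]
  have hpos := ae_pos_chiSquared ν
  rw [chiSquared, gammaMeasure] at hpos ⊢
  have hm : Measurable fun w => ∫⁻ z, f ((z - s₁₂ / √(s₁ * D) * √w) / √s₁) ∂gaussianReal 0 1 :=
    Measurable.lintegral_prod_right' (f := fun r : ℝ × ℝ =>
      f ((r.2 - s₁₂ / √(s₁ * D) * √r.1) / √s₁)) (by fun_prop)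
  rw [← Measure.restrict_eq_self_of_ae_mem (s := Ioi (0 : ℝ)) hpos,
    setLIntegral_withDensity_eq_setLIntegral_mul _ (by unfold gammaPDF; fun_prop) hm
      measurableSet_Ioi, lintegral_Ioi_comp_mul_sq hD, etaIntegral,
      ← lintegral_const_mul' _ _ ENNReal.ofReal_ne_top]
  refine setLIntegral_congr_fun measurableSet_Ioi fun u hu => ?_
  have hu : 0 < u := hu
  simp only [Pi.mul_apply]
  rw [gaussianReal_of_var_ne_zero _ one_ne_zero, lintegral_withDensity_eq_lintegral_mul _
    (by fun_prop) (by fun_prop), lintegral_eq_lintegral_affine hq.ne' (s₁₂ / √s₁ * u), ← mul_assoc,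
    ← mul_assoc, ← lintegral_const_mul' _ _ ENNReal.ofReal_ne_top,
    ← lintegral_const_mul' _ _ (by unfold gammaPDF; finiteness)]
  refine lintegral_congr fun y => ?_
  have harg : (√s₁ * y + s₁₂ / √s₁ * u - s₁₂ / √(s₁ * D) * √(D * u ^ 2)) / √s₁ = y := by
    rw [Real.sqrt_mul hs.le, Real.sqrt_mul hD.le, Real.sqrt_sq hu.le]
    field_simp
    ring
  simp only [Pi.mul_apply, harg]
  rw [← mul_assoc, ← mul_assoc]
  congr 1
  rw [gammaPDF, gaussianPDF, ← ENNReal.ofReal_mul (by positivity),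
    ← ENNReal.ofReal_mul (mul_nonneg (by positivity) (gammaPDFReal_nonneg (by positivity)
      (by norm_num) _)), ← ENNReal.ofReal_mul (mul_nonneg (mul_nonneg (by positivity)
      (gammaPDFReal_nonneg (by positivity) (by norm_num) _)) (abs_nonneg _)),
    ← ENNReal.ofReal_mul hc0.le]
  congr 1
  rw [gammaPDFReal, if_pos (by positivity), abs_of_pos hq, gaussianPDFReal]
  simp only [NNReal.coe_one, mul_one, sub_zero]
  rw [Real.mul_rpow hD.le (by positivity), ← Real.rpow_natCast u 2, ← Real.rpow_mul hu.le]
  have hu1 : u ^ (ν - 1) = u * u ^ (((2 : ℕ) : ℝ) * (ν / 2 - 1)) := by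
    nth_rewrite 2 [← Real.rpow_one u]
    rw [← Real.rpow_add hu]
    congr 1; push_cast; ring
  have hexp : Real.exp (-(s₁ * y ^ 2 + 2 * s₁₂ * y * u + s₂ * u ^ 2) / 2) =
      Real.exp (-(1 / 2 * (D * u ^ ((2 : ℕ) : ℝ)))) *
        Real.exp (-(√s₁ * y + s₁₂ / √s₁ * u) ^ 2 / 2) := by
    rw [← Real.exp_add, hs₂, Real.rpow_natCast]
    congr 1
    have : (√s₁ * y + s₁₂ / √s₁ * u) ^ 2 =
        s₁ * y ^ 2 + 2 * s₁₂ * y * u + s₁₂ ^ 2 / s₁ * u ^ 2 := by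
      rw [add_sq, mul_pow, hq2, mul_pow, div_pow, hq2]
      field_simp
    rw [this]; ring
  rw [Real.rpow_natCast u 2] at hexp ⊢
  rw [hu1, hexp, hc]
  ring

end Star

/-! ### Cholesky form of the likelihood and integration over the means -/

section Posterior

open Set

variable {n : ℕ}

/-- The quadratic form splits into its part about the sample means and `n` times its value at the
means' deviations; the cross terms vanish. -/
theorem sum_cholesky (hn : n ≠ 0) (X : Fin n → ℝ × ℝ) (μ₁ μ₂ p e q : ℝ) :
    ∑ k, ((p * ((X k).1 - μ₁)) ^ 2 + (e * ((X k).1 - μ₁) + q * ((X k).2 - μ₂)) ^ 2) =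
      ((p ^ 2 + e ^ 2) * ss₁ X + 2 * e * q * ss₁₂ X + q ^ 2 * ss₂ X) +
        n * ((p * ((∑ k, (X k).1) / n - μ₁)) ^ 2 +
          (e * ((∑ k, (X k).1) / n - μ₁) + q * ((∑ k, (X k).2) / n - μ₂)) ^ 2) := by
  have hn' : (n : ℝ) ≠ 0 := by exact_mod_cast hn
  have h1 : ∑ k, ((p * ((X k).1 - μ₁)) ^ 2 + (e * ((X k).1 - μ₁) + q * ((X k).2 - μ₂)) ^ 2) =
      (p ^ 2 + e ^ 2) * ∑ k, (X k).1 * (X k).1 + 2 * e * q * ∑ k, (X k).1 * (X k).2 +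
      q ^ 2 * ∑ k, (X k).2 * (X k).2 +
      (-2 * μ₁ * (p ^ 2 + e ^ 2) - 2 * e * q * μ₂) * ∑ k, (X k).1 +
      (-2 * q ^ 2 * μ₂ - 2 * e * q * μ₁) * ∑ k, (X k).2 +
      n * ((p ^ 2 + e ^ 2) * μ₁ ^ 2 + 2 * e * q * μ₁ * μ₂ + q ^ 2 * μ₂ ^ 2) := by
    simp only [Finset.mul_sum, ← Finset.sum_add_distrib]
    rw [show (n : ℝ) * ((p ^ 2 + e ^ 2) * μ₁ ^ 2 + 2 * e * q * μ₁ * μ₂ + q ^ 2 * μ₂ ^ 2) =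
      ∑ _k : Fin n, ((p ^ 2 + e ^ 2) * μ₁ ^ 2 + 2 * e * q * μ₁ * μ₂ + q ^ 2 * μ₂ ^ 2) by
        simp; ring,
      ← Finset.sum_add_distrib]
    exact Finset.sum_congr rfl fun k _ => by ring
  rw [h1]
  simp only [ss₁, ss₁₂, ss₂, crossProduct]
  field_simp
  ring

theorem pdf_eq_cholesky {σ₁ σ₂ ρ : ℝ} (h₁ : 0 < σ₁) (h₂ : 0 < σ₂) (hρ : ρ ∈ Ioo (-1 : ℝ) 1)
    (μ₁ μ₂ : ℝ) (x : ℝ × ℝ) :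
    pdf (μ₁, μ₂, σ₁, σ₂, ρ) x = 1 / σ₁ * (1 / (σ₂ * √(1 - ρ ^ 2))) / (2 * Real.pi) *
      Real.exp (-(((1 / σ₁) * (x.1 - μ₁)) ^ 2 + (eta3 (μ₁, μ₂, σ₁, σ₂, ρ) * (x.1 - μ₁) +
        1 / (σ₂ * √(1 - ρ ^ 2)) * (x.2 - μ₂)) ^ 2) / 2) := by
  have hr : 0 < 1 - ρ ^ 2 := by nlinarith [hρ.1, hρ.2]
  have hr2 := Real.sq_sqrt hr.le
  simp only [pdf, eta3]
  set r := √(1 - ρ ^ 2) with hrdef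
  have hr0 : 0 < r := Real.sqrt_pos.2 hr
  have hπ := Real.pi_pos
  congr 1
  · field_simp
  · congr 1
    rw [← hr2]
    have : ρ ^ 2 = 1 - r ^ 2 := by linarith
    field_simp
    ring_nf
    simp only [this]
    ring

theorem prod_pdf (hn : n ≠ 0) {σ₁ σ₂ ρ : ℝ} (h₁ : 0 < σ₁) (h₂ : 0 < σ₂)
    (hρ : ρ ∈ Ioo (-1 : ℝ) 1) (μ₁ μ₂ : ℝ) (X : Fin n → ℝ × ℝ) {p e q : ℝ} (hp : p = 1 / σ₁)
    (he : e = eta3 (μ₁, μ₂, σ₁, σ₂, ρ)) (hq : q = 1 / (σ₂ * √(1 - ρ ^ 2))) :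
    ∏ k, pdf (μ₁, μ₂, σ₁, σ₂, ρ) (X k) = (p * q / (2 * Real.pi)) ^ n *
      Real.exp (-((p ^ 2 + e ^ 2) * ss₁ X + 2 * e * q * ss₁₂ X + q ^ 2 * ss₂ X) / 2) *
      Real.exp (-(n / 2) * ((p * ((∑ k, (X k).1) / n - μ₁)) ^ 2 +
          (e * ((∑ k, (X k).1) / n - μ₁) + q * ((∑ k, (X k).2) / n - μ₂)) ^ 2)) := by
  simp_rw [pdf_eq_cholesky h₁ h₂ hρ, ← he, ← hp, ← hq]
  rw [Finset.prod_mul_distrib, ← Real.exp_sum, mul_assoc, ← Real.exp_add]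
  simp only [Finset.prod_const, Finset.card_univ, Fintype.card_fin]
  rw [← Finset.sum_div, Finset.sum_neg_distrib, sum_cholesky hn]
  congr 2
  ring

/-- The Gaussian integral `∫ exp (-n x² / 2)`. -/
noncomputable def gaussInt (n : ℕ) : ENNReal :=
  ∫⁻ x : ℝ, ENNReal.ofReal (Real.exp (-((n : ℝ) / 2) * x ^ 2))

theorem gaussInt_ne_zero : gaussInt n ≠ 0 := by
  rw [gaussInt, ← pos_iff_ne_zero, lintegral_pos_iff_support (by fun_prop)]
  have : Function.support (fun x : ℝ => ENNReal.ofReal (Real.exp (-((n : ℝ) / 2) * x ^ 2))) = univ :=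
    eq_univ_of_forall fun x => by simp [Real.exp_pos]
  rw [this]
  simp

theorem gaussInt_ne_top (hn : n ≠ 0) : gaussInt n ≠ ⊤ := by
  have : (0 : ℝ) < n := by exact_mod_cast Nat.pos_of_ne_zero hn
  exact ((integrable_exp_neg_mul_sq (b := (n : ℝ) / 2) (by positivity)).lintegral_lt_top).ne

/-- A triangular change of variables with determinant `pq` up to sign. Its inverse factor lowers the
exponent of `pq` in the likelihood from `n` to `n - 1`. -/
theorem lintegral_means {p q : ℝ} (hp : 0 < p) (hq : 0 < q) (e a b : ℝ) :
    ∫⁻ μ₁, ∫⁻ μ₂, ENNReal.ofReal (Real.exp (-((n : ℝ) / 2) * ((p * (a - μ₁)) ^ 2 +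
      (e * (a - μ₁) + q * (b - μ₂)) ^ 2))) =
      ENNReal.ofReal (1 / (p * q)) * gaussInt n ^ 2 := by
  have h1 : ∀ μ₁, ∫⁻ μ₂, ENNReal.ofReal (Real.exp (-((n : ℝ) / 2) * ((p * (a - μ₁)) ^ 2 +
      (e * (a - μ₁) + q * (b - μ₂)) ^ 2))) =
      ENNReal.ofReal (Real.exp (-((n : ℝ) / 2) * (-p * μ₁ + p * a) ^ 2)) *
        (ENNReal.ofReal q⁻¹ * gaussInt n) := by
    intro μ₁
    have h2 := lintegral_comp_affine (c := -q) (by linarith) (e * (a - μ₁) + q * b)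
      fun x => ENNReal.ofReal (Real.exp (-((n : ℝ) / 2) * x ^ 2))
    rw [abs_neg, abs_of_pos hq] at h2
    rw [gaussInt, ← h2, ← lintegral_const_mul' _ _ ENNReal.ofReal_ne_top]
    refine lintegral_congr fun μ₂ => ?_
    rw [← ENNReal.ofReal_mul (by positivity), ← Real.exp_add]
    congr 2
    ring
  have h3 := lintegral_comp_affine (c := -p) (by linarith) (p * a)
      fun x => ENNReal.ofReal (Real.exp (-((n : ℝ) / 2) * x ^ 2))
  rw [abs_neg, abs_of_pos hp] at h3
  simp_rw [h1]
  rw [lintegral_mul_const _ (by fun_prop), h3, one_div, mul_inv,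
    ENNReal.ofReal_mul (by positivity), ← gaussInt]
  ring

/-- The integral of prior times likelihood over the two means. -/
theorem lintegral_means_prior_mul (a b : ℝ) (hn : n ≠ 0) {σ₁ σ₂ ρ : ℝ} (h₁ : 0 < σ₁) (h₂ : 0 < σ₂)
    (hρ : ρ ∈ Ioo (-1 : ℝ) 1) (X : Fin n → ℝ × ℝ) (f : ℝ → ENNReal) {e q : ℝ}
    (he : e = -(ρ / (σ₁ * √(1 - ρ ^ 2)))) (hq : q = 1 / (σ₂ * √(1 - ρ ^ 2))) :
    ∫⁻ μ₁, ∫⁻ μ₂, ENNReal.ofReal (prior a b (μ₁, μ₂, σ₁, σ₂, ρ) *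
      ∏ k, pdf (μ₁, μ₂, σ₁, σ₂, ρ) (X k)) * f (eta3 (μ₁, μ₂, σ₁, σ₂, ρ)) =
      ENNReal.ofReal (((2 * Real.pi) ^ n)⁻¹) * gaussInt n ^ 2 *
        (ENNReal.ofReal (prior a b (0, 0, σ₁, σ₂, ρ) * (1 / σ₁ * q) ^ ((n : ℝ) - 1) *
        Real.exp (-(((1 / σ₁) ^ 2 + e ^ 2) * ss₁ X + 2 * e * q * ss₁₂ X + q ^ 2 * ss₂ X) / 2)) *
        f e) := by
  have hr : 0 < 1 - ρ ^ 2 := by nlinarith [hρ.1, hρ.2]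
  have hr0 := Real.sqrt_pos.2 hr
  have hπ := Real.pi_pos
  have hq0 : 0 < q := by rw [hq]; positivity
  have hp0 : 0 < 1 / σ₁ := by positivity
  have hprior : ∀ μ₁ μ₂, prior a b (μ₁, μ₂, σ₁, σ₂, ρ) = prior a b (0, 0, σ₁, σ₂, ρ) :=
    fun _ _ => rfl
  have hprior0 : 0 ≤ prior a b (0, 0, σ₁, σ₂, ρ) := by simp only [prior]; positivity
  have heta : ∀ μ₁ μ₂, eta3 (μ₁, μ₂, σ₁, σ₂, ρ) = e := fun _ _ => he.symm
  simp_rw [prod_pdf hn h₁ h₂ hρ _ _ X rfl (heta _ _).symm hq, hprior, heta]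
  set c := (1 / σ₁ * q / (2 * Real.pi)) ^ n *
      Real.exp (-(((1 / σ₁) ^ 2 + e ^ 2) * ss₁ X + 2 * e * q * ss₁₂ X + q ^ 2 * ss₂ X) / 2) with hc
  have hc0 : 0 ≤ c := by positivity
  have hfac : ∀ E : ℝ, ENNReal.ofReal (prior a b (0, 0, σ₁, σ₂, ρ) * (c * E)) * f e =
      ENNReal.ofReal E * (ENNReal.ofReal (prior a b (0, 0, σ₁, σ₂, ρ) * c) * f e) := by
    intro E
    rw [← mul_assoc, ENNReal.ofReal_mul (by positivity), mul_right_comm, mul_comm]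
  simp_rw [hfac]
  have hm : Measurable fun z : ℝ × ℝ => ENNReal.ofReal (Real.exp (-((n : ℝ) / 2) *
      ((1 / σ₁ * ((∑ k, (X k).1) / n - z.1)) ^ 2 + (e * ((∑ k, (X k).1) / n - z.1) +
        q * ((∑ k, (X k).2) / n - z.2)) ^ 2))) := by fun_prop
  have hstep : ∀ μ₁, ∫⁻ μ₂, ENNReal.ofReal (Real.exp (-((n : ℝ) / 2) *
      ((1 / σ₁ * ((∑ k, (X k).1) / n - μ₁)) ^ 2 + (e * ((∑ k, (X k).1) / n - μ₁) +
        q * ((∑ k, (X k).2) / n - μ₂)) ^ 2))) *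
      (ENNReal.ofReal (prior a b (0, 0, σ₁, σ₂, ρ) * c) * f e) =
      (∫⁻ μ₂, ENNReal.ofReal (Real.exp (-((n : ℝ) / 2) *
      ((1 / σ₁ * ((∑ k, (X k).1) / n - μ₁)) ^ 2 + (e * ((∑ k, (X k).1) / n - μ₁) +
        q * ((∑ k, (X k).2) / n - μ₂)) ^ 2)))) *
      (ENNReal.ofReal (prior a b (0, 0, σ₁, σ₂, ρ) * c) * f e) := fun μ₁ =>
    lintegral_mul_const _ (by fun_prop)
  simp_rw [hstep]
  rw [lintegral_mul_const _ hm.lintegral_prod_right', lintegral_means hp0 hq0]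
  have hreal : 1 / (1 / σ₁ * q) * (prior a b (0, 0, σ₁, σ₂, ρ) * c) = ((2 * Real.pi) ^ n)⁻¹ *
      (prior a b (0, 0, σ₁, σ₂, ρ) * (1 / σ₁ * q) ^ ((n : ℝ) - 1) *
        Real.exp (-(((1 / σ₁) ^ 2 + e ^ 2) * ss₁ X + 2 * e * q * ss₁₂ X + q ^ 2 * ss₂ X) / 2)) := by
    rw [Real.rpow_sub_one (by positivity), Real.rpow_natCast, hc, div_pow]
    field_simp
  calc _ = gaussInt n ^ 2 * (ENNReal.ofReal (1 / (1 / σ₁ * q)) *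
        ENNReal.ofReal (prior a b (0, 0, σ₁, σ₂, ρ) * c)) * f e := by ring
    _ = _ := by
      rw [← ENNReal.ofReal_mul (by positivity), hreal, ENNReal.ofReal_mul (by positivity)]
      ring

end Posterior

/-! ### Posterior integrals of functions of `η₃` -/

section PosteriorEta

open Set

variable {n : ℕ}

/-- This is where the form of the prior matters: after `σ₂ = 1/(u√(1-ρ²))` every power of `√(1-ρ²)`
involving `b` cancels, and what remains is the Jacobian of `ρ ↦ ρ/√(1-ρ²)`. -/
theorem prior_mul_jacobian (a b m : ℝ) {σ₁ ρ u : ℝ} (h₁ : 0 < σ₁) (hρ : ρ ∈ Ioo (-1 : ℝ) 1)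
    (hu : 0 < u) :
    1 / (√(1 - ρ ^ 2) * u ^ 2) * (prior a b (0, 0, σ₁, 1 / (u * √(1 - ρ ^ 2)), ρ) *
      (1 / σ₁ * u) ^ (m - 1)) =
      1 / √(1 - ρ ^ 2) ^ 3 * (σ₁ ^ (a - 2 - m) * u ^ (m - b - 1)) := by
  have hr : 0 < 1 - ρ ^ 2 := by nlinarith [hρ.1, hρ.2]
  have hr2 := Real.sq_sqrt hr.le
  simp only [prior]
  set r := √(1 - ρ ^ 2) with hrdef
  have hr0 : 0 < r := Real.sqrt_pos.2 hr
  have e1 : (1 - ρ ^ 2) ^ (2 - b / 2) = r ^ (4 - b) := by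
    rw [← hr2, ← Real.rpow_natCast r 2, ← Real.rpow_mul hr0.le]
    congr 1; push_cast; ring
  have e2 : (1 / (u * r)) ^ (2 - b) = u ^ (b - 2) * r ^ (b - 2) := by
    rw [one_div, Real.inv_rpow (by positivity), ← Real.rpow_neg (by positivity),
      Real.mul_rpow hu.le hr0.le]
    congr 2 <;> ring
  have e3 : (1 / σ₁ * u) ^ (m - 1) = σ₁ ^ (1 - m) * u ^ (m - 1) := by
    rw [Real.mul_rpow (by positivity) hu.le, one_div, Real.inv_rpow h₁.le,
      ← Real.rpow_neg h₁.le]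
    congr 2; ring
  have e4 : σ₁ ^ (a - 2 - m) = σ₁ ^ (1 - m) / σ₁ ^ (3 - a) := by
    rw [← Real.rpow_sub h₁]; congr 1; ring
  have e5 : u ^ (m - b - 1) = u ^ (m - 1) / (u ^ (b - 2) * u ^ 2) := by
    rw [← Real.rpow_natCast u 2, ← Real.rpow_add hu, ← Real.rpow_sub hu]
    congr 1; push_cast; ring
  have e6 : r ^ 3 = r * r ^ (b - 2) * r ^ (4 - b) := by
    rw [mul_assoc, ← Real.rpow_add hr0, show b - 2 + (4 - b) = ((2 : ℕ) : ℝ) by push_cast; ring,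
      Real.rpow_natCast]
    ring
  rw [e1, e2, e3, e4, e5, e6]
  field_simp

/-- The integral of prior times likelihood over `σ₂` and `ρ`. -/
theorem lintegral_sd_corr (a b s₁ s₁₂ s₂ m : ℝ) {σ₁ : ℝ} (h₁ : 0 < σ₁) {f : ℝ → ENNReal}
    (hf : Measurable f) :
    ∫⁻ σ₂ in Ioi 0, ∫⁻ ρ in Ioo (-1) 1, ENNReal.ofReal (prior a b (0, 0, σ₁, σ₂, ρ) *
      (1 / σ₁ * (1 / (σ₂ * √(1 - ρ ^ 2)))) ^ (m - 1) *
        Real.exp (-(((1 / σ₁) ^ 2 + (-(ρ / (σ₁ * √(1 - ρ ^ 2)))) ^ 2) * s₁ +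
          2 * (-(ρ / (σ₁ * √(1 - ρ ^ 2)))) * (1 / (σ₂ * √(1 - ρ ^ 2))) * s₁₂ +
          (1 / (σ₂ * √(1 - ρ ^ 2))) ^ 2 * s₂) / 2)) * f (-(ρ / (σ₁ * √(1 - ρ ^ 2)))) =
      ENNReal.ofReal (σ₁ ^ (a - 1 - m) * Real.exp (-(s₁ / 2 * (1 / σ₁) ^ 2))) *
        etaIntegral (m - b) s₁ s₁₂ s₂ f := by
  -- Substitute `u` for `σ₂` at fixed `ρ`, swap back, then replace `ρ` by `c = ρ/√(1-ρ²)` and `c` by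
  -- `y = -c/σ₁`; the last step contributes one more factor `σ₁`.
  rw [lintegral_lintegral_swap (by simp only [prior]; fun_prop)]
  set g : ℝ → ℝ → ENNReal := fun u c => ENNReal.ofReal (σ₁ ^ (a - 2 - m) * u ^ (m - b - 1) *
    Real.exp (-(((1 / σ₁) ^ 2 + c ^ 2) * s₁ + 2 * c * u * s₁₂ + u ^ 2 * s₂) / 2)) * f c with hg
  have hstep : ∀ ρ ∈ Ioo (-1 : ℝ) 1, ∫⁻ σ₂ in Ioi 0, ENNReal.ofReal (prior a b (0, 0, σ₁, σ₂, ρ) *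
      (1 / σ₁ * (1 / (σ₂ * √(1 - ρ ^ 2)))) ^ (m - 1) *
        Real.exp (-(((1 / σ₁) ^ 2 + (-(ρ / (σ₁ * √(1 - ρ ^ 2)))) ^ 2) * s₁ +
          2 * (-(ρ / (σ₁ * √(1 - ρ ^ 2)))) * (1 / (σ₂ * √(1 - ρ ^ 2))) * s₁₂ +
          (1 / (σ₂ * √(1 - ρ ^ 2))) ^ 2 * s₂) / 2)) * f (-(ρ / (σ₁ * √(1 - ρ ^ 2)))) =
      ∫⁻ u in Ioi 0, ENNReal.ofReal (1 / √(1 - ρ ^ 2) ^ 3) *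
        g u (-(1 / σ₁) * (ρ / √(1 - ρ ^ 2)) + 0) := by
    intro ρ hρ
    have hr : 0 < 1 - ρ ^ 2 := by nlinarith [hρ.1, hρ.2]
    have hr0 := Real.sqrt_pos.2 hr
    rw [lintegral_Ioi_comp_inv hr0]
    refine setLIntegral_congr_fun measurableSet_Ioi fun u hu => ?_
    have hu : 0 < u := hu
    have hq : 1 / (1 / (u * √(1 - ρ ^ 2)) * √(1 - ρ ^ 2)) = u := by field_simp
    have he : -(1 / σ₁) * (ρ / √(1 - ρ ^ 2)) + 0 = -(ρ / (σ₁ * √(1 - ρ ^ 2))) := by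
      field_simp; ring
    simp only [hq, hg, he]
    rw [← mul_assoc, ← mul_assoc, ← ENNReal.ofReal_mul (by positivity),
      ← ENNReal.ofReal_mul (by positivity), ← mul_assoc, prior_mul_jacobian a b m h₁ hρ hu]
    congr 2
    ring
  rw [setLIntegral_congr_fun measurableSet_Ioo hstep,
    lintegral_lintegral_swap (by simp only [hg]; fun_prop), etaIntegral,
    ← lintegral_const_mul' _ _ ENNReal.ofReal_ne_top]
  refine setLIntegral_congr_fun measurableSet_Ioi fun u hu => ?_
  have hu : 0 < u := hu
  rw [← lintegral_eq_lintegral_Ioo_div_sqrt fun c => g u (-(1 / σ₁) * c + 0),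
    lintegral_comp_affine (by simpa using h₁.ne') 0 (g u), abs_neg, abs_of_pos (by positivity),
    ← lintegral_const_mul' _ _ ENNReal.ofReal_ne_top,
    ← lintegral_const_mul' _ _ ENNReal.ofReal_ne_top]
  refine lintegral_congr fun y => ?_
  simp only [hg]
  rw [← mul_assoc, ← mul_assoc, ← ENNReal.ofReal_mul (by positivity),
    ← ENNReal.ofReal_mul (by positivity)]
  congr 2
  rw [one_div, inv_inv, show a - 1 - m = a - 2 - m + 1 by ring, Real.rpow_add_one h₁.ne']
  rw [mul_mul_mul_comm, ← Real.exp_add, ← mul_assoc, ← mul_assoc, mul_comm σ₁]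
  congr 2
  ring

theorem volume_restrict_paramSpace :
    (volume : Measure Param).restrict paramSpace =
      (volume : Measure ℝ).prod ((volume : Measure ℝ).prod ((volume.restrict (Ioi (0 : ℝ))).prod
        ((volume.restrict (Ioi (0 : ℝ))).prod (volume.restrict (Ioo (-1 : ℝ) 1))))) := by
  have : paramSpace = univ ×ˢ univ ×ˢ Ioi (0 : ℝ) ×ˢ Ioi (0 : ℝ) ×ˢ Ioo (-1 : ℝ) 1 := by
    ext ⟨μ₁, μ₂, σ₁, σ₂, ρ⟩
    simp [paramSpace]
  rw [this, Measure.volume_eq_prod, ← Measure.prod_restrict, Measure.restrict_univ,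
    Measure.volume_eq_prod, ← Measure.prod_restrict, Measure.restrict_univ,
    Measure.volume_eq_prod, ← Measure.prod_restrict,
    Measure.volume_eq_prod, ← Measure.prod_restrict]

@[fun_prop]
theorem measurable_eta3 : Measurable eta3 := by
  change Measurable fun θ : Param => -(θ.2.2.2.2 / (θ.2.2.1 * √(1 - θ.2.2.2.2 ^ 2)))
  fun_prop

@[fun_prop]
theorem measurable_prior (a b : ℝ) : Measurable (prior a b) := by
  change Measurable fun θ : Param => 1 / (θ.2.2.1 ^ (3 - a) * θ.2.2.2.1 ^ (2 - b) *
    (1 - θ.2.2.2.2 ^ 2) ^ (2 - b / 2))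
  fun_prop

@[fun_prop]
theorem measurable_pdf_param (x : ℝ × ℝ) : Measurable fun θ => pdf θ x := by
  change Measurable fun θ : Param => 1 / (2 * Real.pi * θ.2.2.1 * θ.2.2.2.1 *
      √(1 - θ.2.2.2.2 ^ 2)) *
      Real.exp (-((θ.2.2.2.1 ^ 2 * (x.1 - θ.1) ^ 2 + θ.2.2.1 ^ 2 * (x.2 - θ.2.1) ^ 2
          - 2 * θ.2.2.2.2 * θ.2.2.1 * θ.2.2.2.1 * (x.1 - θ.1) * (x.2 - θ.2.1)) /
        (2 * θ.2.2.1 ^ 2 * θ.2.2.2.1 ^ 2 * (1 - θ.2.2.2.2 ^ 2))))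
  fun_prop

/-- The integral over `σ₁` of its marginal posterior density, up to a constant. -/
noncomputable def sdIntegral (a m s₁ : ℝ) : ENNReal :=
  ∫⁻ σ₁ in Ioi 0, ENNReal.ofReal (σ₁ ^ (a - 1 - m) * Real.exp (-(s₁ / 2 * (1 / σ₁) ^ 2)))

theorem sdIntegral_ne_zero (a m s₁ : ℝ) : sdIntegral a m s₁ ≠ 0 := by
  rw [sdIntegral, ← pos_iff_ne_zero, setLIntegral_pos_iff (by fun_prop)]
  have : Ioi (0 : ℝ) ⊆ Function.support (fun σ₁ : ℝ => ENNReal.ofReal (σ₁ ^ (a - 1 - m) *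
      Real.exp (-(s₁ / 2 * (1 / σ₁) ^ 2)))) := by
    intro x hx
    have hx : 0 < x := hx
    simp only [Function.mem_support, ne_eq, ENNReal.ofReal_eq_zero, not_le]
    positivity
  rw [inter_eq_right.2 this]
  simp

/-- Inverting `σ₁` gives a Gaussian moment of order `m - a - 1`, which exceeds `-1` exactly when `a
< m`. -/
theorem sdIntegral_ne_top {a m s₁ : ℝ} (ha : a < m) (hs : 0 < s₁) : sdIntegral a m s₁ ≠ ⊤ := by
  have hint := integrableOn_rpow_mul_exp_neg_mul_sq (b := s₁ / 2) (s := m - a - 1) (by positivity)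
    (by linarith)
  rw [sdIntegral, lintegral_Ioi_comp_inv one_pos]
  refine ne_of_eq_of_ne (setLIntegral_congr_fun measurableSet_Ioi fun u hu => ?_)
    hint.lintegral_lt_top.ne
  have hu : 0 < u := hu
  rw [← ENNReal.ofReal_mul (by positivity), ← mul_assoc]
  congr 2
  · rw [mul_one, one_mul, one_div, one_div, Real.inv_rpow hu.le, ← Real.rpow_neg hu.le,
      ← Real.rpow_natCast u 2, ← Real.rpow_neg hu.le, ← Real.rpow_add hu]
    congr 1; push_cast; ring
  · rw [mul_one, one_div_one_div]
    congr 1; ring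

/-- Tonelli with the means innermost and `σ₁` outermost. The inner integrals depend on `σ₁` only
through a scalar factor, so the result is a product, and `a` affects only a constant independent of
`f`. -/
theorem lintegral_priorTimesLikelihood (a b : ℝ) (hn : n ≠ 0) (X : Fin n → ℝ × ℝ)
    {f : ℝ → ENNReal} (hf : Measurable f) :
    ∫⁻ θ, f (eta3 θ) ∂priorTimesLikelihood a b X =
      ENNReal.ofReal (((2 * Real.pi) ^ n)⁻¹) * gaussInt n ^ 2 * sdIntegral a n (ss₁ X) *
        etaIntegral ((n : ℝ) - b) (ss₁ X) (ss₁₂ X) (ss₂ X) f := by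
  have hm : Measurable fun θ => ENNReal.ofReal (prior a b θ * ∏ k, pdf θ (X k)) * f (eta3 θ) := by
    fun_prop
  rw [priorTimesLikelihood, lintegral_withDensity_eq_lintegral_mul _ (by fun_prop) (by fun_prop),
    volume_restrict_paramSpace, lintegral_prod _ (by fun_prop)]
  simp only [Pi.mul_apply]
  have hγ : ∀ μ₁ : ℝ, ∫⁻ y, ENNReal.ofReal (prior a b (μ₁, y) * ∏ k, pdf (μ₁, y) (X k)) *
      f (eta3 (μ₁, y)) ∂(volume : Measure ℝ).prod ((volume.restrict (Ioi (0 : ℝ))).prod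
        ((volume.restrict (Ioi (0 : ℝ))).prod (volume.restrict (Ioo (-1 : ℝ) 1)))) =
      ∫⁻ γ, (∫⁻ μ₂, ENNReal.ofReal (prior a b (μ₁, μ₂, γ) * ∏ k, pdf (μ₁, μ₂, γ) (X k)) *
      f (eta3 (μ₁, μ₂, γ))) ∂(volume.restrict (Ioi (0 : ℝ))).prod
        ((volume.restrict (Ioi (0 : ℝ))).prod (volume.restrict (Ioo (-1 : ℝ) 1))) := fun μ₁ =>
    lintegral_prod_symm _ (by fun_prop)
  simp_rw [hγ]
  have hm2 : Measurable fun z : ℝ × ℝ × ℝ × ℝ => ∫⁻ μ₂, ENNReal.ofReal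
      (prior a b (z.1, μ₂, z.2) * ∏ k, pdf (z.1, μ₂, z.2) (X k)) * f (eta3 (z.1, μ₂, z.2)) :=
    Measurable.lintegral_prod_right' (f := fun r : (ℝ × ℝ × ℝ × ℝ) × ℝ => ENNReal.ofReal
      (prior a b (r.1.1, r.2, r.1.2) * ∏ k, pdf (r.1.1, r.2, r.1.2) (X k)) *
        f (eta3 (r.1.1, r.2, r.1.2)))
      (hm.comp (g := fun θ => ENNReal.ofReal (prior a b θ * ∏ k, pdf θ (X k)) * f (eta3 θ))
        (f := fun r : (ℝ × ℝ × ℝ × ℝ) × ℝ => (r.1.1, r.2, r.1.2)) (by fun_prop))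
  rw [lintegral_lintegral_swap hm2.aemeasurable]
  have hm3 : Measurable fun z : ℝ × ℝ × ℝ => ∫⁻ μ₁, ∫⁻ μ₂, ENNReal.ofReal
      (prior a b (μ₁, μ₂, z) * ∏ k, pdf (μ₁, μ₂, z) (X k)) * f (eta3 (μ₁, μ₂, z)) :=
    hm2.lintegral_prod_left'
  rw [lintegral_prod _ hm3.aemeasurable, sdIntegral, mul_assoc,
    ← lintegral_mul_const'' _ (by fun_prop), ← lintegral_const_mul'' _ (by fun_prop)]
  refine setLIntegral_congr_fun measurableSet_Ioi fun σ₁ h₁ => ?_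
  have hm4 : Measurable fun y : ℝ × ℝ => ∫⁻ μ₁, ∫⁻ μ₂, ENNReal.ofReal
      (prior a b (μ₁, μ₂, σ₁, y) * ∏ k, pdf (μ₁, μ₂, σ₁, y) (X k)) * f (eta3 (μ₁, μ₂, σ₁, y)) :=
    hm3.comp measurable_prodMk_left
  rw [← lintegral_sd_corr a b _ _ _ _ h₁ hf, lintegral_prod _ hm4.aemeasurable,
    ← lintegral_const_mul' _ _ (ENNReal.mul_ne_top ENNReal.ofReal_ne_top
      (ENNReal.pow_ne_top (gaussInt_ne_top hn)))]
  refine setLIntegral_congr_fun measurableSet_Ioi fun σ₂ h₂ => ?_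
  rw [← lintegral_const_mul' _ _ (ENNReal.mul_ne_top ENNReal.ofReal_ne_top
      (ENNReal.pow_ne_top (gaussInt_ne_top hn)))]
  refine setLIntegral_congr_fun measurableSet_Ioo fun ρ hρ => ?_
  exact lintegral_means_prior_mul a b hn h₁ h₂ hρ X f rfl rfl

end PosteriorEta

/-! ### The posterior law of `η₃` and the coverage formula -/

section Coverage

open Set

variable {n : ℕ}

/-- The sample correlation `r` enters through `r / √(1 - r²)`. -/
noncomputable def sampleRatio (X : Fin n → ℝ × ℝ) : ℝ := ss₁₂ X / √(ss₁ X * rss X)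

/-- The posterior is proper, and it gives `η₃` the law of `(Z* - t √χ*) / √S₁₁`. -/
theorem posterior_map_eta3 {a b : ℝ} (ha : a < n) (hb : b < n) (hn : n ≠ 0)
    {X : Fin n → ℝ × ℝ} (hs : 0 < ss₁ X) (hD : 0 < rss X) :
    IsProbabilityMeasure (posterior a b X) ∧
    (posterior a b X).map eta3 = ((gaussianReal 0 1).prod (chiSquared ((n : ℝ) - b))).map
      fun p => (p.1 - sampleRatio X * √p.2) / √(ss₁ X) := by
  have hν : 0 < (n : ℝ) - b := by linarith
  have i1 := isProbabilityMeasure_chiSquared hν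
  obtain ⟨C, hC0, hCt, hC⟩ := lintegral_star hν hs hD
  set K := ENNReal.ofReal (((2 * Real.pi) ^ n)⁻¹) * gaussInt n ^ 2 * sdIntegral a n (ss₁ X) with hK
  have hπ := Real.pi_pos
  have hK0 : K ≠ 0 := by
    refine mul_ne_zero (mul_ne_zero ?_ (pow_ne_zero _ gaussInt_ne_zero)) (sdIntegral_ne_zero _ _ _)
    simp only [ne_eq, ENNReal.ofReal_eq_zero, not_le]
    positivity
  have hKt : K ≠ ⊤ := ENNReal.mul_ne_top (ENNReal.mul_ne_top ENNReal.ofReal_ne_top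
    (ENNReal.pow_ne_top (gaussInt_ne_top hn))) (sdIntegral_ne_top ha hs)
  have hL : ∀ f : ℝ → ENNReal, Measurable f → ∫⁻ θ, f (eta3 θ) ∂priorTimesLikelihood a b X =
      K * C⁻¹ * ∫⁻ p, f ((p.1 - sampleRatio X * √p.2) / √(ss₁ X))
        ∂(gaussianReal 0 1).prod (chiSquared ((n : ℝ) - b)) := by
    intro f hf
    rw [lintegral_priorTimesLikelihood a b hn X hf, ← hK, sampleRatio, rss, hC f hf, mul_assoc K,
      ← mul_assoc C⁻¹, ENNReal.inv_mul_cancel hC0 hCt, one_mul]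
  have hM : priorTimesLikelihood a b X univ = K * C⁻¹ := by
    have := hL (fun _ => 1) measurable_const
    simpa using this
  have hM0 : K * C⁻¹ ≠ 0 := mul_ne_zero hK0 (ENNReal.inv_ne_zero.2 hCt)
  have hMt : K * C⁻¹ ≠ ⊤ := ENNReal.mul_ne_top hKt (ENNReal.inv_ne_top.2 hC0)
  refine ⟨⟨?_⟩, Measure.ext_of_lintegral _ fun f hf => ?_⟩
  · rw [posterior, hM, Measure.smul_apply, hM, smul_eq_mul, ENNReal.inv_mul_cancel hM0 hMt]
  · rw [lintegral_map hf (by fun_prop), lintegral_map hf (by fun_prop), posterior,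
      lintegral_smul_measure, hL f hf, hM, smul_eq_mul, ← mul_assoc,
      ENNReal.inv_mul_cancel hM0 hMt, one_mul]

theorem lt_eta3Quantile_iff {a b α : ℝ} (ha : a < n) (hb : b < n) (hn : n ≠ 0)
    (hα : α ∈ Ioo (0 : ℝ) 1) {X : Fin n → ℝ × ℝ} (hs : 0 < ss₁ X) (hD : 0 < rss X) (x : ℝ) :
    x < eta3Quantile a b α X ↔
      starCDF ((n : ℝ) - b) (-(x * √(ss₁ X))) (sampleRatio X) < 1 - α := by
  obtain ⟨hP, hmap⟩ := posterior_map_eta3 ha hb hn hs hD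
  have : IsProbabilityMeasure ((posterior a b X).map eta3) :=
    Measure.isProbabilityMeasure_map (by fun_prop)
  rw [eta3Quantile, lt_quantile_iff _ ⟨by linarith [hα.2], by linarith [hα.1]⟩, hmap,
    map_measureReal_apply (by fun_prop) measurableSet_Iic, starCDF]
  have hset : (fun p : ℝ × ℝ => (p.1 - sampleRatio X * √p.2) / √(ss₁ X)) ⁻¹' Iic x =
      {p | p.1 + -(x * √(ss₁ X)) ≤ sampleRatio X * √p.2} := by
    ext p
    simp only [mem_preimage, mem_Iic, mem_ofPred_eq]
    rw [div_le_iff₀ (Real.sqrt_pos.2 hs)]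
    constructor <;> intro h <;> linarith
  rw [hset]

theorem posterior_lt_eta3Quantile {a b α : ℝ} (ha : a < n) (hb : b < n) (hn : n ≠ 0)
    (hα : α ∈ Ioo (0 : ℝ) 1) {X : Fin n → ℝ × ℝ} (hs : 0 < ss₁ X) (hD : 0 < rss X) :
    posterior a b X {θ | eta3 θ < eta3Quantile a b α X} = ENNReal.ofReal (1 - α) := by
  obtain ⟨hP, hmap⟩ := posterior_map_eta3 ha hb hn hs hD
  have i1 := isProbabilityMeasure_chiSquared (show 0 < (n : ℝ) - b by linarith)
  have : IsProbabilityMeasure ((posterior a b X).map eta3) :=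
    Measure.isProbabilityMeasure_map (by fun_prop)
  have hq := Real.sqrt_pos.2 hs
  have hatom : ∀ x, (posterior a b X).map eta3 {x} = 0 := by
    intro x
    rw [hmap, Measure.map_apply (by fun_prop) (measurableSet_singleton x),
      ← gaussian_prod_graph_eq_zero (chiSquared ((n : ℝ) - b))
        (g := fun w => x * √(ss₁ X) + sampleRatio X * √w) (by fun_prop)]
    congr 1
    ext p
    simp only [mem_preimage, mem_singleton_iff, mem_ofPred_eq]
    rw [div_eq_iff hq.ne', sub_eq_iff_eq_add]
  have key := measureReal_Iio_quantile _ hatom (p := 1 - α)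
    ⟨by linarith [hα.2], by linarith [hα.1]⟩
  rw [map_measureReal_apply (by fun_prop) measurableSet_Iio] at key
  rw [← key, ofReal_measureReal]
  rfl

theorem ae_pos_chi (n : ℕ) (hn : 3 ≤ n) : ∀ᵐ q ∂(gaussianReal 0 1).prod
    ((chiSquared ((n : ℝ) - 1)).prod (chiSquared ((n : ℝ) - 2))), 0 < q.2.1 ∧ 0 < q.2.2 := by
  have hn3 : (3 : ℝ) ≤ n := by exact_mod_cast hn
  have i1 := isProbabilityMeasure_chiSquared (show 0 < (n : ℝ) - 1 by linarith)
  have i2 := isProbabilityMeasure_chiSquared (show 0 < (n : ℝ) - 2 by linarith)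
  exact ((Measure.quasiMeasurePreserving_fst.comp Measure.quasiMeasurePreserving_snd).ae
    (ae_pos_chiSquared _)).and
    ((Measure.quasiMeasurePreserving_snd.comp Measure.quasiMeasurePreserving_snd).ae
    (ae_pos_chiSquared _))

theorem ae_sampleLaw_pos (hn : 3 ≤ n) {σ₁ σ₂ ρ : ℝ} (h₁ : 0 < σ₁) (h₂ : 0 < σ₂)
    (hρ : ρ ∈ Ioo (-1 : ℝ) 1) (μ₁ μ₂ : ℝ) :
    ∀ᵐ X ∂sampleLaw n (μ₁, μ₂, σ₁, σ₂, ρ), 0 < ss₁ X ∧ 0 < rss X := by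
  have hr : 0 < 1 - ρ ^ 2 := by nlinarith [hρ.1, hρ.2]
  have h : ∀ᵐ q ∂(sampleLaw n (μ₁, μ₂, σ₁, σ₂, ρ)).map (fun X => (ss₁ X, ss₁₂ X, rss X)),
      0 < q.1 ∧ 0 < q.2.2 := by
    rw [sampleLaw_map_statistics hn h₁ h₂ hρ, ae_map_iff (by fun_prop)
      (by measurability)]
    filter_upwards [ae_pos_chi n hn] with q hq
    have hq1 := hq.1
    have hq2 := hq.2
    constructor <;> positivity
  exact ae_of_ae_map (p := fun q : ℝ × ℝ × ℝ => 0 < q.1 ∧ 0 < q.2.2) (by fun_prop) h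

/-- The coverage formula in terms of the distribution function of the star variable. -/
theorem coverageFormula_eq_starCDF {b α : ℝ} (hb : b < n) (hα : α ∈ Ioo (0 : ℝ) 1) (ρ : ℝ) :
    coverageFormula n b α ρ = ((gaussianReal 0 1).prod
      ((chiSquared ((n : ℝ) - 1)).prod (chiSquared ((n : ℝ) - 2)))).real
      {p | starCDF ((n : ℝ) - b) (ρ / √(1 - ρ ^ 2) * √p.2.1)
        ((p.1 + ρ / √(1 - ρ ^ 2) * √p.2.1) / √p.2.2) < 1 - α} := by
  simp only [coverageFormula, lt_starQuantile_iff (show 0 < (n : ℝ) - b by linarith) hα]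

theorem coverage_eq_coverageFormula (hn : 3 ≤ n) {a b α : ℝ} (ha : a < n) (hb : b < n)
    (hα : α ∈ Ioo (0 : ℝ) 1) {σ₁ σ₂ ρ : ℝ} (h₁ : 0 < σ₁) (h₂ : 0 < σ₂)
    (hρ : ρ ∈ Ioo (-1 : ℝ) 1) (μ₁ μ₂ : ℝ) :
    coverage n a b α (μ₁, μ₂, σ₁, σ₂, ρ) = coverageFormula n b α ρ := by
  have hr : 0 < 1 - ρ ^ 2 := by nlinarith [hρ.1, hρ.2]
  have hr0 := Real.sqrt_pos.2 hr
  have hν : 0 < (n : ℝ) - b := by linarith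
  set η := eta3 (μ₁, μ₂, σ₁, σ₂, ρ) with hη
  have hm : Measurable fun q : ℝ × ℝ × ℝ =>
      starCDF ((n : ℝ) - b) (-(η * √q.1)) (q.2.1 / √(q.1 * q.2.2)) :=
    (measurable_starCDF hν).comp (f := fun q : ℝ × ℝ × ℝ =>
      (-(η * √q.1), q.2.1 / √(q.1 * q.2.2))) (by fun_prop)
  have hS : MeasurableSet {q : ℝ × ℝ × ℝ |
      starCDF ((n : ℝ) - b) (-(η * √q.1)) (q.2.1 / √(q.1 * q.2.2)) < 1 - α} :=
    measurableSet_lt hm measurable_const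
  calc coverage n a b α (μ₁, μ₂, σ₁, σ₂, ρ)
      = (sampleLaw n (μ₁, μ₂, σ₁, σ₂, ρ)).real ((fun X => (ss₁ X, ss₁₂ X, rss X)) ⁻¹'
        {q : ℝ × ℝ × ℝ |
          starCDF ((n : ℝ) - b) (-(η * √q.1)) (q.2.1 / √(q.1 * q.2.2)) < 1 - α}) := by
        refine measureReal_congr ?_
        filter_upwards [ae_sampleLaw_pos hn h₁ h₂ hρ μ₁ μ₂] with X hX
        exact propext (lt_eta3Quantile_iff ha hb (by omega) hα hX.1 hX.2 η)
    _ = _ := by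
        rw [← map_measureReal_apply (by fun_prop) hS, sampleLaw_map_statistics hn h₁ h₂ hρ,
          map_measureReal_apply (by fun_prop) hS, coverageFormula_eq_starCDF hb hα]
        refine measureReal_congr ?_
        filter_upwards [ae_pos_chi n hn] with p hp
        have hp1 := Real.sqrt_pos.2 hp.1
        have hp2 := Real.sqrt_pos.2 hp.2
        -- It remains to match shift and threshold: `σ₁` cancels in `-η₃√S₁₁`, and both `σ₁` and
        -- `σ₂` cancel in `S₁₂/√(S₁₁D)`.
        refine congrArg (· < 1 - α) ?_
        simp only [hη, eta3]
        congr 1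
        · rw [Real.sqrt_mul (by positivity), Real.sqrt_sq h₁.le]
          field_simp
        · rw [show σ₁ ^ 2 * p.2.1 * (σ₂ ^ 2 * (1 - ρ ^ 2) * p.2.2) =
            (σ₁ * σ₂) ^ 2 * (p.2.1 * ((1 - ρ ^ 2) * p.2.2)) by ring, Real.sqrt_mul (by positivity),
            Real.sqrt_sq (by positivity), Real.sqrt_mul hp.1.le, Real.sqrt_mul hr.le]
          field_simp
          ring

end Coverage

/-! ### Comparing chi-squared tails -/

section ChiSquaredComparison

open Set Filter Topology

theorem chiSquared_singleton (ν x : ℝ) : chiSquared ν {x} = 0 :=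
  chiSquared_absolutelyContinuous ν (by simp)

theorem chiSquared_apply_eq_lintegral (ν : ℝ) {s : Set ℝ} (hs : MeasurableSet s) :
    chiSquared ν s = ∫⁻ x in s, gammaPDF (ν / 2) (1 / 2) x :=
  withDensity_apply _ hs

theorem gammaPDF_pos {ν x : ℝ} (hν : 0 < ν) (hx : 0 < x) : 0 < gammaPDF (ν / 2) (1 / 2) x :=
  ENNReal.ofReal_pos.2 (gammaPDFReal_pos (by positivity) (by norm_num) hx)

theorem chiSquared_Ioo_pos {ν x y : ℝ} (hν : 0 < ν) (hx : 0 ≤ x) (hxy : x < y) :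
    0 < chiSquared ν (Ioo x y) := by
  rw [chiSquared_apply_eq_lintegral ν measurableSet_Ioo, setLIntegral_pos_iff
    (by unfold gammaPDF; fun_prop)]
  have : Ioo x y ⊆ Function.support (gammaPDF (ν / 2) (1 / 2)) := fun w hw =>
    (gammaPDF_pos hν (hx.trans_lt hw.1)).ne'
  rw [inter_eq_right.2 this]
  simpa using hxy

theorem chiSquared_Ioi_quantile {ν α : ℝ} (hν : 0 < ν) (hα : α ∈ Ioo (0 : ℝ) 1) :
    0 < quantile (chiSquared ν) α ∧
      (chiSquared ν).real (Ioi (quantile (chiSquared ν) α)) = 1 - α := by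
  have i1 := isProbabilityMeasure_chiSquared hν
  have hIio := measureReal_Iio_quantile _ (chiSquared_singleton ν) hα
  set q := quantile (chiSquared ν) α
  constructor
  · by_contra! hneg
    have : (chiSquared ν).real (Iio q) = 0 := by
      rw [measureReal_eq_zero_iff, measure_eq_zero_iff_ae_notMem]
      filter_upwards [ae_pos_chiSquared ν] with x hx
      simp only [mem_Iio, not_lt]
      linarith
    linarith [hα.1]
  · rw [← hIio, ← probReal_compl_eq_one_sub measurableSet_Iio, compl_Iio]
    refine measureReal_congr ?_
    filter_upwards [measure_eq_zero_iff_ae_notMem.1 (chiSquared_singleton ν q)] with x hx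
    exact propext ⟨fun h => le_of_lt h, fun h => lt_of_le_of_ne h (Ne.symm hx)⟩

/-- The tail function of the chi-squared distribution crosses `1 - α` at its `α` quantile. -/
theorem chiSquared_Ioi_lt_iff {ν α w : ℝ} (hν : 0 < ν) (hα : α ∈ Ioo (0 : ℝ) 1) (hw : 0 < w)
    (hwq : w ≠ quantile (chiSquared ν) α) :
    (chiSquared ν).real (Ioi w) ≠ 1 - α ∧
      ((chiSquared ν).real (Ioi w) < 1 - α ↔ quantile (chiSquared ν) α < w) := by
  have i1 := isProbabilityMeasure_chiSquared hν
  obtain ⟨hq0, hq⟩ := chiSquared_Ioi_quantile hν hα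
  set q := quantile (chiSquared ν) α
  -- The tail is strictly decreasing on the positive axis because every interval there has positive
  -- mass.
  have key : ∀ x y : ℝ, 0 < x → x < y →
      (chiSquared ν).real (Ioi y) < (chiSquared ν).real (Ioi x) := by
    intro x y hx hxy
    have h1 : 0 < (chiSquared ν).real (Ioo x y) :=
      ENNReal.toReal_pos (chiSquared_Ioo_pos hν hx.le hxy).ne' (measure_ne_top _ _)
    have h2 : (chiSquared ν).real (Ioo x y ∪ Ioi y) ≤ (chiSquared ν).real (Ioi x) :=
      measureReal_mono (union_subset Ioo_subset_Ioi_self (Ioi_subset_Ioi hxy.le))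
    rw [measureReal_union ((Iic_disjoint_Ioi le_rfl).mono_left
      (Ioo_subset_Iio_self.trans Iio_subset_Iic_self))
      measurableSet_Ioi] at h2
    linarith
  rw [← hq]
  rcases lt_or_gt_of_ne hwq with h | h
  · have := key w q hw h
    exact ⟨this.ne', iff_of_false this.not_gt h.not_gt⟩
  · have := key q w hq0 h
    exact ⟨this.ne, iff_of_true this h⟩

/-- Monotone likelihood ratio: the quotient of the densities is a constant times a power of `x`,
increasing when `ν < ν'`. -/
theorem gammaPDFReal_ratio {ν ν' x : ℝ} (hν : 0 < ν) (hx : 0 < x) :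
    gammaPDFReal (ν' / 2) (1 / 2) x =
      ((1 / 2) ^ (ν' / 2) / Real.Gamma (ν' / 2)) / ((1 / 2) ^ (ν / 2) / Real.Gamma (ν / 2)) *
        x ^ ((ν' - ν) / 2) * gammaPDFReal (ν / 2) (1 / 2) x := by
  have hΓ := Real.Gamma_pos_of_pos (show 0 < ν / 2 by positivity)
  simp only [gammaPDFReal, if_pos hx.le]
  rw [show ν' / 2 - 1 = (ν' - ν) / 2 + (ν / 2 - 1) by ring, Real.rpow_add hx]
  have : (0 : ℝ) < (1 / 2) ^ (ν / 2) := by positivity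
  field_simp

/-- Chi-squared quantiles are strictly increasing in the degrees of freedom. -/
theorem chiSquared_Ioi_ne {ν ν' q : ℝ} (hν : 0 < ν) (hνν' : ν < ν') (hq : 0 < q) :
    (chiSquared ν).real (Ioi q) ≠ (chiSquared ν').real (Ioi q) := by
  have hν' : 0 < ν' := hν.trans hνν'
  have i1 := isProbabilityMeasure_chiSquared hν
  have i2 := isProbabilityMeasure_chiSquared hν'
  set C : ℝ := ((1 / 2) ^ (ν' / 2) / Real.Gamma (ν' / 2)) /
    ((1 / 2) ^ (ν / 2) / Real.Gamma (ν / 2)) with hC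
  have hC0 : 0 < C := by
    have := Real.Gamma_pos_of_pos (show 0 < ν / 2 by positivity)
    have := Real.Gamma_pos_of_pos (show 0 < ν' / 2 by positivity)
    positivity
  have hd : 0 < (ν' - ν) / 2 := by linarith
  intro heq
  -- If the density ratio at `q` is at most `1`, it is below `1` on all of `(0, q)`, so the masses
  -- there differ; otherwise it exceeds `1` on all of `(q, ∞)`, and the tails differ directly.
  rcases le_or_gt (C * q ^ ((ν' - ν) / 2)) 1 with h | h
  · have hlt : chiSquared ν' (Ioo 0 q) < chiSquared ν (Ioo 0 q) := by
      rw [chiSquared_apply_eq_lintegral _ measurableSet_Ioo,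
        chiSquared_apply_eq_lintegral _ measurableSet_Ioo]
      refine setLIntegral_strict_mono measurableSet_Ioo (by simpa using hq)
        (by unfold gammaPDF; fun_prop) ?_ (ae_of_all _ fun x hx => ?_)
      · rw [← chiSquared_apply_eq_lintegral _ measurableSet_Ioo]
        exact measure_ne_top _ _
      · have hp := gammaPDFReal_pos (show 0 < ν / 2 by positivity) (by norm_num : (0 : ℝ) < 1 / 2)
          hx.1
        refine (ENNReal.ofReal_lt_ofReal_iff hp).2 ?_
        rw [gammaPDFReal_ratio (ν := ν) hν hx.1, ← hC]
        refine mul_lt_of_lt_one_left hp (lt_of_lt_of_le ?_ h)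
        exact mul_lt_mul_of_pos_left (Real.rpow_lt_rpow hx.1.le hx.2 hd) hC0
    have hIoo : ∀ κ : ℝ, 0 < κ → (chiSquared κ).real (Ioo 0 q) =
        1 - (chiSquared κ).real (Ioi q) := by
      intro κ hκ
      have := isProbabilityMeasure_chiSquared hκ
      rw [← probReal_compl_eq_one_sub measurableSet_Ioi, compl_Ioi]
      refine measureReal_congr ?_
      filter_upwards [ae_pos_chiSquared κ,
        measure_eq_zero_iff_ae_notMem.1 (chiSquared_singleton κ q)] with x hx hxq
      exact propext ⟨fun h => h.2.le, fun h => ⟨hx, lt_of_le_of_ne h hxq⟩⟩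
    have := (ENNReal.toReal_lt_toReal (measure_ne_top _ _) (measure_ne_top _ _)).2 hlt
    rw [← measureReal_def, ← measureReal_def, hIoo ν hν, hIoo ν' hν'] at this
    linarith
  · have hlt : chiSquared ν (Ioi q) < chiSquared ν' (Ioi q) := by
      rw [chiSquared_apply_eq_lintegral _ measurableSet_Ioi,
        chiSquared_apply_eq_lintegral _ measurableSet_Ioi]
      refine setLIntegral_strict_mono measurableSet_Ioi (by simp)
        (by unfold gammaPDF; fun_prop) ?_ (ae_of_all _ fun x hx => ?_)
      · rw [← chiSquared_apply_eq_lintegral _ measurableSet_Ioi]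
        exact measure_ne_top _ _
      · have hx0 : 0 < x := hq.trans hx
        have hp := gammaPDFReal_pos (show 0 < ν / 2 by positivity) (by norm_num : (0 : ℝ) < 1 / 2)
          hx0
        have hp' := gammaPDFReal_pos (show 0 < ν' / 2 by positivity)
          (by norm_num : (0 : ℝ) < 1 / 2) hx0
        refine (ENNReal.ofReal_lt_ofReal_iff hp').2 ?_
        rw [gammaPDFReal_ratio (ν' := ν') hν hx0, ← hC]
        refine lt_mul_of_one_lt_left hp (h.trans ?_)
        exact mul_lt_mul_of_pos_left (Real.rpow_lt_rpow hq.le hx hd) hC0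
    have := (ENNReal.toReal_lt_toReal (measure_ne_top _ _) (measure_ne_top _ _)).2 hlt
    exact absurd heq this.ne

theorem eq_of_chiSquared_Ioi_eq {ν ν' q : ℝ} (hν : 0 < ν) (hν' : 0 < ν') (hq : 0 < q)
    (h : (chiSquared ν).real (Ioi q) = (chiSquared ν').real (Ioi q)) : ν = ν' := by
  rcases lt_trichotomy ν ν' with h' | h' | h'
  · exact absurd h (chiSquared_Ioi_ne hν h' hq)
  · exact h'
  · exact absurd h.symm (chiSquared_Ioi_ne hν' h' hq)

end ChiSquaredComparison

/-! ### Exact matching -/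

section Matching

open Set Filter Topology

theorem measurableSet_starCDF_lt {ν : ℝ} (hν : 0 < ν) (c x : ℝ) :
    MeasurableSet {p : ℝ × ℝ × ℝ | starCDF ν (c * √p.2.1) ((p.1 + c * √p.2.1) / √p.2.2) < x} :=
  measurableSet_lt ((measurable_starCDF hν).comp (f := fun p : ℝ × ℝ × ℝ =>
      (c * √p.2.1, (p.1 + c * √p.2.1) / √p.2.2)) (by fun_prop)) measurable_const

/-- Given `χ²_{n-1}`, the sampled ratio and the ratio defining the quantile are equal in law, so
every conditional coverage is already `1 - α`. -/
theorem coverageFormula_two {n : ℕ} (hn : 3 ≤ n) {α : ℝ} (hα : α ∈ Ioo (0 : ℝ) 1) (ρ : ℝ) :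
    coverageFormula n 2 α ρ = 1 - α := by
  have hn3 : (3 : ℝ) ≤ n := by exact_mod_cast hn
  have hν : 0 < (n : ℝ) - 2 := by linarith
  have i1 := isProbabilityMeasure_chiSquared (show 0 < (n : ℝ) - 1 by linarith)
  have i2 := isProbabilityMeasure_chiSquared hν
  have hS := measurableSet_starCDF_lt hν (ρ / √(1 - ρ ^ 2)) (1 - α)
  rw [coverageFormula_eq_starCDF (by linarith) hα, measureReal_def,
    ← lintegral_indicator_one hS, lintegral_prod_middle _ _ _
      (measurable_one.indicator hS)]
  have h : ∀ a, ∫⁻ q, {p : ℝ × ℝ × ℝ | starCDF ((n : ℝ) - 2) (ρ / √(1 - ρ ^ 2) * √p.2.1)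
      ((p.1 + ρ / √(1 - ρ ^ 2) * √p.2.1) / √p.2.2) < 1 - α}.indicator (1 : ℝ × ℝ × ℝ → ENNReal)
      (q.1, a, q.2) ∂(gaussianReal 0 1).prod (chiSquared ((n : ℝ) - 2)) =
      ENNReal.ofReal (1 - α) := by
    intro a
    have key := measureReal_lt_starQuantile hν hα (ρ / √(1 - ρ ^ 2) * √a)
    simp only [lt_starQuantile_iff hν hα] at key
    rw [← congrArg ENNReal.ofReal key, ofReal_measureReal, ← lintegral_indicator_one]
    · rfl
    · exact hS.preimage (f := fun q : ℝ × ℝ => (q.1, a, q.2)) (by fun_prop)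
  simp_rw [h]
  simp [ENNReal.toReal_ofReal (show 0 ≤ 1 - α by linarith [hα.2])]

/-- Dividing by `k s`, the inequality `Z* + k s ≤ (z + k s)√χ*/√w` tends to `1 ≤ √(χ*/w)`; the
boundary `χ* = w` is null, so indicators converge almost surely. -/
theorem tendsto_starCDF {ν s w : ℝ} (hν : 0 < ν) (hs : 0 < s) (hw : 0 < w) (z : ℝ) :
    Tendsto (fun k : ℕ => starCDF ν (k * s) ((z + k * s) / √w)) atTop
      (𝓝 ((chiSquared ν).real (Ioi w))) := by
  have i1 := isProbabilityMeasure_chiSquared hν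
  have hsw := Real.sqrt_pos.2 hw
  have hlim : (chiSquared ν).real (Ioi w) =
      ((gaussianReal 0 1).prod (chiSquared ν)).real {p | w < p.2} := by
    have : {p : ℝ × ℝ | w < p.2} = univ ×ˢ Ioi w := by ext; simp
    rw [this, measureReal_prod_prod]
    simp
  rw [hlim]
  refine (ENNReal.tendsto_toReal (measure_ne_top _ _)).comp ?_
  refine tendsto_measure_of_ae_tendsto_indicator_of_isFiniteMeasure atTop
    (measurableSet_lt measurable_const measurable_snd)
    (fun k => measurableSet_le (by fun_prop) (by fun_prop)) ?_
  have hne : ∀ᵐ p ∂(gaussianReal 0 1).prod (chiSquared ν), p.2 ≠ w :=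
    Measure.quasiMeasurePreserving_snd.ae (measure_eq_zero_iff_ae_notMem.1
      (chiSquared_singleton ν w))
  filter_upwards [hne, ae_pos_snd ν] with p hp hp0
  have hkey : ∀ k : ℕ, p.1 + k * s ≤ (z + k * s) / √w * √p.2 ↔
      p.1 - z * (√p.2 / √w) ≤ k * (s * (√p.2 / √w - 1)) := by
    intro k
    have : (z + k * s) / √w * √p.2 = z * (√p.2 / √w) + k * s * (√p.2 / √w) := by
      field_simp
    rw [this]
    constructor <;> intro h <;> linarith
  simp only [hkey]
  rcases lt_or_gt_of_ne hp with h | h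
  · have hneg : s * (√p.2 / √w - 1) < 0 := by
      refine mul_neg_of_pos_of_neg hs ?_
      rw [sub_neg, div_lt_one hsw]
      exact Real.sqrt_lt_sqrt hp0.le h
    have ht := (tendsto_natCast_atTop_atTop (R := ℝ)).atTop_mul_const_of_neg hneg
    filter_upwards [ht.eventually_lt_atBot (p.1 - z * (√p.2 / √w))] with k hk
    exact iff_of_false hk.not_ge h.not_gt
  · have hpos : 0 < s * (√p.2 / √w - 1) := by
      refine mul_pos hs ?_
      rw [sub_pos, one_lt_div hsw]
      exact Real.sqrt_lt_sqrt hw.le h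
    have ht := (tendsto_natCast_atTop_atTop (R := ℝ)).atTop_mul_const hpos
    filter_upwards [ht.eventually_ge_atTop (p.1 - z * (√p.2 / √w))] with k hk
    exact iff_of_true hk h

/-- As `ρ → 1` the coverage converges to a probability on the chi-squared scale alone. -/
theorem tendsto_coverageFormula {n : ℕ} (hn : 3 ≤ n) {b α : ℝ} (hb : b < n)
    (hα : α ∈ Ioo (0 : ℝ) 1) :
    Tendsto (fun k : ℕ => coverageFormula n b α (k / √(1 + (k : ℝ) ^ 2))) atTop
      (𝓝 ((chiSquared ((n : ℝ) - 2)).real (Ioi (quantile (chiSquared ((n : ℝ) - b)) α)))) := by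
  have hn3 : (3 : ℝ) ≤ n := by exact_mod_cast hn
  have hν : 0 < (n : ℝ) - b := by linarith
  have i1 := isProbabilityMeasure_chiSquared (show 0 < (n : ℝ) - 1 by linarith)
  have i2 := isProbabilityMeasure_chiSquared (show 0 < (n : ℝ) - 2 by linarith)
  set q := quantile (chiSquared ((n : ℝ) - b)) α
  have hlim : (chiSquared ((n : ℝ) - 2)).real (Ioi q) = ((gaussianReal 0 1).prod
      ((chiSquared ((n : ℝ) - 1)).prod (chiSquared ((n : ℝ) - 2)))).real {p | q < p.2.2} := by
    have : {p : ℝ × ℝ × ℝ | q < p.2.2} = univ ×ˢ univ ×ˢ Ioi q := by ext; simp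
    rw [this, measureReal_prod_prod, measureReal_prod_prod]
    simp
  rw [hlim]
  simp only [coverageFormula_eq_starCDF hb hα, div_sqrt_one_sub_sq]
  refine (ENNReal.tendsto_toReal (measure_ne_top _ _)).comp ?_
  refine tendsto_measure_of_ae_tendsto_indicator_of_isFiniteMeasure atTop
    (measurableSet_lt measurable_const (by fun_prop))
    (fun k => measurableSet_starCDF_lt hν k (1 - α)) ?_
  have hne : ∀ᵐ p ∂(gaussianReal 0 1).prod
      ((chiSquared ((n : ℝ) - 1)).prod (chiSquared ((n : ℝ) - 2))), p.2.2 ≠ q :=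
    (Measure.quasiMeasurePreserving_snd.comp Measure.quasiMeasurePreserving_snd).ae
      (measure_eq_zero_iff_ae_notMem.1 (chiSquared_singleton _ q))
  filter_upwards [hne, ae_pos_chi n hn] with p hp hpos
  have ht := tendsto_starCDF hν (Real.sqrt_pos.2 hpos.1) hpos.2 p.1
  -- Away from the null event `p.2.2 = q` the limit of the distribution functions differs from `1 -
  -- α`, so the strict comparison with `1 - α` is eventually constant in `k`.
  obtain ⟨h1, h2⟩ := chiSquared_Ioi_lt_iff hν hα hpos.2 hp
  rw [← h2]
  rcases lt_or_gt_of_ne h1 with h | h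
  · filter_upwards [ht.eventually (gt_mem_nhds h)] with k hk
    exact iff_of_true hk h
  · filter_upwards [ht.eventually (lt_mem_nhds h)] with k hk
    exact iff_of_false hk.not_gt h.not_gt

theorem coverageFormula_matching_iff {n : ℕ} (hn : 3 ≤ n) {b α : ℝ} (hb : b < n)
    (hα : α ∈ Ioo (0 : ℝ) 1) :
    (∀ ρ ∈ Ioo (-1 : ℝ) 1, coverageFormula n b α ρ = 1 - α) ↔ b = 2 := by
  have hn3 : (3 : ℝ) ≤ n := by exact_mod_cast hn
  refine ⟨fun h => ?_, fun h ρ _ => by rw [h, coverageFormula_two hn hα]⟩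
  have hν : 0 < (n : ℝ) - b := by linarith
  have ht := tendsto_coverageFormula hn hb hα
  -- Correlations `k/√(1+k²)` tending to `1`, for which `ρ/√(1-ρ²) = k`, suffice to force `b = 2`.
  have hconst : ∀ k : ℕ, coverageFormula n b α (k / √(1 + (k : ℝ) ^ 2)) = 1 - α :=
    fun k => h _ (div_sqrt_mem_Ioo k)
  simp only [hconst] at ht
  have h1 := tendsto_nhds_unique tendsto_const_nhds ht
  obtain ⟨hq0, hq⟩ := chiSquared_Ioi_quantile hν hα
  have := eq_of_chiSquared_Ioi_eq hν (show 0 < (n : ℝ) - 2 by linarith) hq0 (hq.trans h1)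
  linarith

end Matching

end BivariateNormal

theorem theorem3 (n : ℕ) (hn : 3 ≤ n) (a b : ℝ) (ha : a < n) (hb : b < n)
    (α : ℝ) (hα : α ∈ Set.Ioo (0 : ℝ) 1) :
    (∀ μ₁ μ₂ σ₁ σ₂ ρ : ℝ, 0 < σ₁ → 0 < σ₂ → ρ ∈ Set.Ioo (-1 : ℝ) 1 →
      -- the posterior is proper and the posterior quantile has its defining property
      (∀ᵐ X ∂BivariateNormal.sampleLaw n (μ₁, μ₂, σ₁, σ₂, ρ),
        MeasureTheory.IsProbabilityMeasure (BivariateNormal.posterior a b X) ∧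
        BivariateNormal.posterior a b X
            {θ | BivariateNormal.eta3 θ < BivariateNormal.eta3Quantile a b α X} =
          ENNReal.ofReal (1 - α)) ∧
      -- the coverage formula
      BivariateNormal.coverage n a b α (μ₁, μ₂, σ₁, σ₂, ρ) =
        BivariateNormal.coverageFormula n b α ρ) ∧
    -- exact matching
    (∀ μ₁ μ₂ σ₁ σ₂ : ℝ, 0 < σ₁ → 0 < σ₂ →
      ((∀ ρ ∈ Set.Ioo (-1 : ℝ) 1,
          BivariateNormal.coverage n a b α (μ₁, μ₂, σ₁, σ₂, ρ) = 1 - α) ↔ b = 2)) := by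
  have hn0 : n ≠ 0 := by omega
  refine ⟨fun μ₁ μ₂ σ₁ σ₂ ρ h₁ h₂ hρ => ⟨?_, ?_⟩, fun μ₁ μ₂ σ₁ σ₂ h₁ h₂ => ?_⟩
  · filter_upwards [BivariateNormal.ae_sampleLaw_pos hn h₁ h₂ hρ μ₁ μ₂] with X hX
    exact ⟨(BivariateNormal.posterior_map_eta3 ha hb hn0 hX.1 hX.2).1,
      BivariateNormal.posterior_lt_eta3Quantile ha hb hn0 hα hX.1 hX.2⟩
  · exact BivariateNormal.coverage_eq_coverageFormula hn ha hb hα h₁ h₂ hρ μ₁ μ₂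
  · rw [← BivariateNormal.coverageFormula_matching_iff hn hb hα]
    refine forall₂_congr fun ρ hρ => ?_
    rw [BivariateNormal.coverage_eq_coverageFormula hn ha hb hα h₁ h₂ hρ μ₁ μ₂]
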